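/- Write $\overline{\mathbb R}=(-\infty,\infty]$ and $\operatorname{dom}\varphi=\{x : \varphi(x)<\infty\}$. A function $\vartheta:\mathbb R^m\to\overline{\mathbb R}$ is *piecewise linear-quadratic* if $\operatorname{dom}\vartheta$ is a union of finitely many polyhedral convex sets, on each of which $\vartheta(y)=\frac12\langle Ay,y\rangle+\langle a,y\rangle+\alpha$ with some symmetric matrix $A$, vector $a$ and scalar $\alpha$. A function $\varphi:\mathbb R^n\to\overline{\mathbb R}$ is *fully subamenable* at $\bar x\in\operatorname{dom}\varphi$ if on a neighborhood of $\bar x$ it has a representation $\varphi=\vartheta\circ f$, where $f:\mathbb R^n\to\mathbb R^m$ is twice differentiable at $\bar x$ (differentiable near $\bar x$, with derivative differentiable at $\bar x$), $\vartheta:\mathbb R^m\to\overline{\mathbb R}$ is convex piecewise linear-quadratic, and for some $\kappa'\ge 0$ one has $\operatorname{dist}(x;\{z : f(z)\in\operatorname{dom}\vartheta\})\le\kappa'\operatorname{dist}(f(x);\operatorname{dom}\vartheta)$ for all $x$ near $\bar x$. Let $\partial$ denote the limiting (Mordukhovich) subdifferential: $v\in\partial\varphi(\bar x)$ if and only if $(v,-1)$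 is a limiting normal to $\operatorname{epi}\varphi$ at $(\bar x,\varphi(\bar x))$. The second subderivative is $$\mathrm d^2\varphi(\bar x,\bar v)(w)=\liminf_{t\downarrow0,\;u\to w}\frac{\varphi(\bar x+tu)-\varphi(\bar x)-t\langle\bar v,u\rangle}{\frac12t^2}\in[-\infty,\infty].$$ **Theorem.** Let $\varphi_1,\dots,\varphi_s:\mathbb R^n\to\overline{\mathbb R}$ be fully subamenable at $\bar x\in\bigcap_{i=1}^s\operatorname{dom}\varphi_i$, and let $\varphi=\sum_{i=1}^s\varphi_i$. Suppose that there are numbers $\kappa\ge0$ and $\varepsilon>0$ such that $$\operatorname{dist}\Big(x;\bigcap_{i=1}^s\operatorname{dom}\varphi_i\Big)\le\kappa\sum_{i=1}^s\operatorname{dist}(x;\operatorname{dom}\varphi_i)\quad\text{whenever }\|x-\bar x\|\le\varepsilon.$$ Then $\varphi$ is fully subamenable at $\bar x$. Moreover, for every $\bar v\in\partial\varphi(\bar x)$ and every $w\in\mathbb R^n$, $$\mathrm d^2\varphi(\bar x,\bar v)(w)=\max\Big\{\sum_{i=1}^s\mathrm d^2\varphi_i(\bar x,v_i)(w)\;\Big|\;v_i\in\partial\varphi_i(\bar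 x),\ \sum_{i=1}^sv_i=\bar v\Big\},$$ where the maximum (with values in $(-\infty,\infty]$) is attained, and where none of the terms $\mathrm d^2\varphi_i(\bar x,v_i)(w)$ with $v_i\in\partial\varphi_i(\bar x)$ equals $-\infty$, so that the sums are well defined. -/

import Mathlib

open Filter Topology

noncomputable section

namespace VarAnalysis

/-- The effective domain of an extended-real-valued function. -/
def dom {E : Type*} (φ : E → EReal) : Set E := {x | φ x < ⊤}

section Euclidean

variable {E : Type*} [NormedAddCommGroup E] [InnerProductSpace ℝ E]

/-- The epigraph, as a subset of the Hilbert product of `E` and `ℝ`. -/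
def epi (φ : E → EReal) : Set (WithLp 2 (E × ℝ)) := {z | φ z.fst ≤ (z.snd : EReal)}

/-- The regular (Fréchet) normal cone: the limsup of `⟪v, y - x⟫ / ‖y - x‖` as `y → x`
within `Ω` is at most `0`. It is meant for `x ∈ Ω`. -/
def regularNormalCone (Ω : Set E) (x : E) : Set E :=
  {v | ∀ ε : ℝ, 0 < ε → ∀ᶠ y in 𝓝[Ω] x, inner ℝ v (y - x) ≤ ε * ‖y - x‖}

/-- The limiting (Mordukhovich) normal cone; it is empty for `x ∉ Ω`. -/
def limitingNormalCone (Ω : Set E) (x : E) : Set E :=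
  {v | x ∈ Ω ∧ ∃ (y : ℕ → E) (u : ℕ → E), (∀ k, y k ∈ Ω) ∧ Tendsto y atTop (𝓝 x) ∧
    Tendsto u atTop (𝓝 v) ∧ ∀ k, u k ∈ regularNormalCone Ω (y k)}

/-- The limiting subdifferential of `φ` at a point `x` where `φ` is finite:
`(v, -1)` is a limiting normal to the epigraph at `(x, φ x)`. -/
def limitingSubdifferential (φ : E → EReal) (x : E) : Set E :=
  {v | WithLp.toLp 2 (v, (-1 : ℝ)) ∈
    limitingNormalCone (epi φ) (WithLp.toLp 2 (x, (φ x).toReal))}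

/-- The second-order difference quotient
`(φ (x + t w) - φ x - t ⟪v, w⟫) / (t² / 2)`, for `φ x` finite and `t > 0`. -/
def secondQuotient (φ : E → EReal) (x v : E) (t : ℝ) (w : E) : EReal :=
  (φ (x + t • w) - φ x - ((t * inner ℝ v w : ℝ) : EReal)) / ((t ^ 2 / 2 : ℝ) : EReal)

/-- The second subderivative: the lower limit of the second-order difference quotients
at `u` as `t ↓ 0` and `u → w`, with values in `[-∞, ∞]`. -/
def secondSubderivative (φ : E → EReal) (x v w : E) : EReal :=
  liminf (fun p : ℝ × E => secondQuotient φ x v p.1 p.2) (𝓝[>] (0 : ℝ) ×ˢ 𝓝 w)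

/-- Polyhedral convex sets: intersections of finitely many closed half-spaces. -/
def IsPolyhedral (Ω : Set E) : Prop :=
  ∃ (k : ℕ) (b : Fin k → E) (β : Fin k → ℝ), Ω = {x | ∀ j, inner ℝ (b j) x ≤ β j}

/-- Piecewise linear-quadratic functions: the domain is a union of finitely many polyhedral
convex sets, on each of which the function is given by
`½ ⟪A x, x⟫ + ⟪a, x⟫ + α` with `A` symmetric. -/
def IsPLQ (θ : E → EReal) : Prop :=
  ∃ (k : ℕ) (Ω : Fin k → Set E) (A : Fin k → E →ₗ[ℝ] E) (a : Fin k → E) (α : Fin k → ℝ),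
    (∀ i, IsPolyhedral (Ω i)) ∧ (∀ i, (A i).IsSymmetric) ∧ dom θ = ⋃ i, Ω i ∧
    ∀ i, ∀ x ∈ Ω i,
      θ x = ((1 / 2 * inner ℝ (A i x) x + inner ℝ (a i) x + α i : ℝ) : EReal)

/-- Convexity of an extended-real-valued function, through its epigraph. -/
def IsConvexFun (θ : E → EReal) : Prop := Convex ℝ (epi θ)

/-- Twice differentiability at a point: differentiability on a neighborhood of it, and
differentiability of the derivative at it. -/
def TwiceDifferentiableAt {F : Type*} [NormedAddCommGroup F] [NormedSpace ℝ F]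
    (f : E → F) (x : E) : Prop :=
  (∀ᶠ y in 𝓝 x, DifferentiableAt ℝ f y) ∧ DifferentiableAt ℝ (fderiv ℝ f) x

/-- The metric subregularity qualification condition for the composition `θ ∘ f` at `x`:
`dist (y; {z | f z ∈ dom θ}) ≤ κ dist (f y; dom θ)` for all `y` near `x`.
It is meant for `f x ∈ dom θ`, so that both sets are nonempty. -/
def MSQC {F : Type*} [NormedAddCommGroup F] (θ : F → EReal) (f : E → F) (x : E) : Prop :=
  ∃ κ : ℝ, 0 ≤ κ ∧ ∀ᶠ y in 𝓝 x,
    Metric.infDist y {z | f z ∈ dom θ} ≤ κ * Metric.infDist (f y) (dom θ)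

/-- `φ` is fully subamenable at `x ∈ dom φ`: near `x` it is a composition `θ ∘ f` of a convex
piecewise linear-quadratic function with a mapping that is twice differentiable at `x`,
such that the metric subregularity qualification condition holds at `x`. -/
def FullySubamenableAt (φ : E → EReal) (x : E) : Prop :=
  x ∈ dom φ ∧ ∃ (m : ℕ) (f : E → EuclideanSpace ℝ (Fin m))
    (θ : EuclideanSpace ℝ (Fin m) → EReal),
    TwiceDifferentiableAt f x ∧ IsConvexFun θ ∧ IsPLQ θ ∧ MSQC θ f x ∧
    ∀ᶠ y in 𝓝 x, φ y = θ (f y)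

end Euclidean

end VarAnalysis

end

noncomputable section

namespace VarAnalysis

section Euclidean

variable {E F : Type*} [NormedAddCommGroup E] [InnerProductSpace ℝ E]
  [NormedAddCommGroup F] [InnerProductSpace ℝ F]

/-! ### Extended-real-valued functions without the value `⊥` -/

/-! Near `x₀` write `φ i = θ i ∘ f i`, stack the `f i` into one map `f` into a product space and let
`θ` be the separable sum of the `θ i`. The condition on the domains merges the separate
subregularity estimates into one for `θ ∘ f` (`MSQC.sum`), so the sum is fully subamenable and the
sum rule reduces to chain rules for `θ ∘ f`.

One inequality is soft: lower limits are superadditive, so every decomposition of `v₀` gives a lower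
bound (`sum_secondSubderivative_le`). For attainment, `MSQC.exists_subgradient` yields a subgradient
`l` of `θ` at `f x₀` that the adjoint derivative of `f` maps to `v₀`; its components decompose `v₀`.
No term is `⊥`, so if some term is `⊤` this decomposition is optimal. Otherwise `IsPLQ.ray` forces
each `θ i` to be quadratic along the image of `w`, with slope matching `l` and some curvature `q i`.
Then a possibly different subgradient `l'` satisfies d²φ(w) ≤ ∑ q i + ⟨l', f''(w, w)⟩
(`MSQC.exists_subgradient_secondSubderivative_le`), while each summand is at least q i + ⟨l'_i,
f_i''(w, w)⟩ (`le_secondSubderivative_comp`).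

Both multipliers arise in the same way. Subregularity allows test points to be corrected into the
domain at a cost proportional to the constraint violation (`MSQC.exists_correction`). This turns the
definitions of normals and of the second subderivative into inequalities with a norm penalty, and
the Hahn–Banach theorem dualizes these (`exists_multiplier`). -/

theorem coe_toReal_of_mem_dom {X : Type*} {θ : X → EReal} (hb : ∀ y, θ y ≠ ⊥) {y : X}
    (hy : y ∈ dom θ) :
    ((θ y).toReal : EReal) = θ y :=
  EReal.coe_toReal (ne_of_lt hy) (hb y)

theorem eq_top_of_notMem_dom {X : Type*} {θ : X → EReal} {y : X} (hy : y ∉ dom θ) : θ y = ⊤ := by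
  simpa [dom] using hy

theorem isConvexFun_iff {θ : F → EReal} (hb : ∀ y, θ y ≠ ⊥) :
    IsConvexFun θ ↔ ConvexOn ℝ (dom θ) (fun y => (θ y).toReal) := by
  constructor
  · intro h
    have key : ∀ x ∈ dom θ, ∀ y ∈ dom θ, ∀ a b : ℝ, 0 ≤ a → 0 ≤ b → a + b = 1 →
        θ (a • x + b • y) ≤ ((a * (θ x).toReal + b * (θ y).toReal : ℝ) : EReal) := by
      intro x hx y hy a b ha hb' hab
      have hx' : WithLp.toLp 2 (x, (θ x).toReal) ∈ epi θ := by
        simp [epi, coe_toReal_of_mem_dom hb hx]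
      have hy' : WithLp.toLp 2 (y, (θ y).toReal) ∈ epi θ := by
        simp [epi, coe_toReal_of_mem_dom hb hy]
      simpa [epi] using h hx' hy' ha hb' hab
    refine ⟨fun x hx y hy a b ha hb' hab =>
      (key x hx y hy a b ha hb' hab).trans_lt (EReal.coe_lt_top _), ?_⟩
    intro x hx y hy a b ha hb' hab
    have h1 := key x hx y hy a b ha hb' hab
    have h2 : a • x + b • y ∈ dom θ := h1.trans_lt (EReal.coe_lt_top _)
    rw [← coe_toReal_of_mem_dom hb h2] at h1
    simpa using (EReal.coe_le_coe_iff.1 h1)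
  · intro h p hp q hq a b ha hb' hab
    have hp1 : p.fst ∈ dom θ := lt_of_le_of_lt hp (EReal.coe_lt_top _)
    have hq1 : q.fst ∈ dom θ := lt_of_le_of_lt hq (EReal.coe_lt_top _)
    have hp2 : (θ p.fst).toReal ≤ p.snd := by
      have : θ p.fst ≤ (p.snd : EReal) := hp
      rw [← coe_toReal_of_mem_dom hb hp1] at this
      exact EReal.coe_le_coe_iff.1 this
    have hq2 : (θ q.fst).toReal ≤ q.snd := by
      have : θ q.fst ≤ (q.snd : EReal) := hq
      rw [← coe_toReal_of_mem_dom hb hq1] at this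
      exact EReal.coe_le_coe_iff.1 this
    have h1 := h.2 hp1 hq1 ha hb' hab
    have h2 := h.1 hp1 hq1 ha hb' hab
    change θ ((a • p + b • q).fst) ≤ (((a • p + b • q).snd : ℝ) : EReal)
    have e1 : (a • p + b • q).fst = a • p.fst + b • q.fst := rfl
    have e2 : (a • p + b • q).snd = a * p.snd + b * q.snd := rfl
    rw [e1, e2, ← coe_toReal_of_mem_dom hb h2, EReal.coe_le_coe_iff]
    simp only [smul_eq_mul] at h1
    nlinarith

/-- The subgradients, in the sense of convex analysis, of `θ` at a point `y` of its domain. -/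
def IsSubgradient (θ : F → EReal) (y l : F) : Prop :=
  ∀ y' ∈ dom θ, (θ y).toReal + inner ℝ l (y' - y) ≤ (θ y').toReal

/-! ### Polyhedral sets and piecewise linear-quadratic functions -/

theorem IsPLQ.ne_bot {θ : F → EReal} (h : IsPLQ θ) (y : F) : θ y ≠ ⊥ := by
  obtain ⟨k, Ω, A, a, α, -, -, hd, hq⟩ := h
  by_cases hy : y ∈ dom θ
  · rw [hd] at hy
    obtain ⟨i, hi⟩ := Set.mem_iUnion.1 hy
    rw [hq i y hi]
    exact EReal.coe_ne_bot _
  · rw [eq_top_of_notMem_dom hy]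
    exact top_ne_bot

theorem IsPolyhedral.isClosed {Ω : Set F} (h : IsPolyhedral Ω) : IsClosed Ω := by
  obtain ⟨k, b, β, rfl⟩ := h
  rw [Set.ofPred_forall]
  exact isClosed_iInter fun j => isClosed_le (by fun_prop) continuous_const

theorem IsPolyhedral.convex {Ω : Set F} (h : IsPolyhedral Ω) : Convex ℝ Ω := by
  obtain ⟨k, b, β, rfl⟩ := h
  rw [Set.ofPred_forall]
  exact convex_iInter fun j => convex_halfSpace_le (innerₛₗ ℝ (b j)).isLinear (β j)

theorem IsPolyhedral.univ : IsPolyhedral (Set.univ : Set F) :=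
  ⟨0, Fin.elim0, Fin.elim0, by ext; simp⟩

theorem IsPolyhedral.inter {Ω Ω' : Set F} (h : IsPolyhedral Ω) (h' : IsPolyhedral Ω') :
    IsPolyhedral (Ω ∩ Ω') := by
  obtain ⟨k, b, β, rfl⟩ := h
  obtain ⟨k', b', β', rfl⟩ := h'
  refine ⟨k + k', Fin.append b b', Fin.append β β', ?_⟩
  ext x
  simp only [Set.mem_inter_iff, Set.mem_ofPred_eq]
  rw [Fin.forall_fin_add]
  simp

theorem IsPolyhedral.preimage [FiniteDimensional ℝ E] [FiniteDimensional ℝ F]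
    {Ω : Set F} (h : IsPolyhedral Ω) (L : E →ₗ[ℝ] F) : IsPolyhedral (L ⁻¹' Ω) := by
  obtain ⟨k, b, β, rfl⟩ := h
  refine ⟨k, fun j => LinearMap.adjoint L (b j), β, ?_⟩
  ext x
  simp [LinearMap.adjoint_inner_left]

theorem IsPLQ.comp_linearMap [FiniteDimensional ℝ E] [FiniteDimensional ℝ F]
    {θ : F → EReal} (h : IsPLQ θ) (L : E →ₗ[ℝ] F) : IsPLQ (fun x => θ (L x)) := by
  obtain ⟨k, Ω, A, a, α, hΩ, hA, hd, hq⟩ := h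
  refine ⟨k, fun i => L ⁻¹' Ω i, fun i => LinearMap.adjoint L ∘ₗ A i ∘ₗ L,
    fun i => LinearMap.adjoint L (a i), α, fun i => (hΩ i).preimage L, ?_, ?_, ?_⟩
  · intro i x y
    simp only [LinearMap.comp_apply, LinearMap.adjoint_inner_left, LinearMap.adjoint_inner_right]
    exact hA i _ _
  · ext x
    have : L x ∈ dom θ ↔ L x ∈ ⋃ i, Ω i := by rw [hd]
    simpa [dom] using this
  · intro i x hx
    simpa only [LinearMap.comp_apply, LinearMap.adjoint_inner_left] using hq i (L x) hx

theorem dom_add {X : Type*} {θ θ' : X → EReal} (h : ∀ y, θ y ≠ ⊥) (h' : ∀ y, θ' y ≠ ⊥) :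
    dom (fun y => θ y + θ' y) = dom θ ∩ dom θ' := by
  ext y
  simp only [dom, Set.mem_ofPred_eq, Set.mem_inter_iff, lt_top_iff_ne_top]
  exact EReal.add_ne_top_iff_ne_top₂ (h y) (h' y)

theorem IsPLQ.add {θ θ' : F → EReal} (h : IsPLQ θ) (h' : IsPLQ θ') :
    IsPLQ (fun y => θ y + θ' y) := by
  have hb := h.ne_bot
  have hb' := h'.ne_bot
  obtain ⟨k, Ω, A, a, α, hΩ, hA, hd, hq⟩ := h
  obtain ⟨k', Ω', A', a', α', hΩ', hA', hd', hq'⟩ := h'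
  -- The pieces of the sum are the pairwise intersections of the given pieces.
  let e : Fin (k * k') ≃ Fin k × Fin k' := finProdFinEquiv.symm
  refine ⟨k * k', fun i => Ω (e i).1 ∩ Ω' (e i).2, fun i => A (e i).1 + A' (e i).2,
    fun i => a (e i).1 + a' (e i).2, fun i => α (e i).1 + α' (e i).2,
    fun i => (hΩ _).inter (hΩ' _), fun i => (hA _).add (hA' _), ?_, ?_⟩
  · rw [dom_add hb hb', hd, hd']
    ext y
    simp only [Set.mem_inter_iff, Set.mem_iUnion]
    constructor
    · rintro ⟨⟨i, hi⟩, ⟨j, hj⟩⟩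
      exact ⟨e.symm (i, j), by simpa using ⟨hi, hj⟩⟩
    · rintro ⟨i, hi, hj⟩
      exact ⟨⟨_, hi⟩, ⟨_, hj⟩⟩
  · intro i y hy
    change θ y + θ' y = _
    rw [hq _ y hy.1, hq' _ y hy.2, ← EReal.coe_add]
    congr 1
    simp only [LinearMap.add_apply, inner_add_left]
    ring

theorem IsPLQ.zero : IsPLQ (fun _ : F => (0 : EReal)) :=
  ⟨1, fun _ => Set.univ, fun _ => 0, fun _ => 0, fun _ => 0, fun _ => IsPolyhedral.univ,
    fun _ x y => by simp, by ext; simp [dom], fun _ x _ => by simp⟩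

theorem sum_ne_bot {ι : Type*} (s : Finset ι) (c : ι → EReal) (h : ∀ i ∈ s, c i ≠ ⊥) :
    ∑ i ∈ s, c i ≠ ⊥ := by
  classical
  induction s using Finset.induction_on with
  | empty => simp
  | insert i s hi ih =>
    rw [Finset.sum_insert hi]
    exact EReal.add_ne_bot_iff.2 ⟨h i (Finset.mem_insert_self i s),
      ih fun j hj => h j (Finset.mem_insert_of_mem hj)⟩

theorem sum_lt_top_iff {ι : Type*} (s : Finset ι) (c : ι → EReal) (h : ∀ i ∈ s, c i ≠ ⊥) :
    ∑ i ∈ s, c i < ⊤ ↔ ∀ i ∈ s, c i < ⊤ := by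
  classical
  induction s using Finset.induction_on with
  | empty => simp
  | insert i s hi ih =>
    have h1 := fun j hj => h j (Finset.mem_insert_of_mem hj)
    have h2 : _ ↔ _ := EReal.add_ne_top_iff_ne_top₂ (h i (Finset.mem_insert_self i s))
      (sum_ne_bot s c h1)
    rw [Finset.sum_insert hi, lt_top_iff_ne_top, h2, ← lt_top_iff_ne_top, ← lt_top_iff_ne_top,
      ih h1, Finset.forall_mem_insert]

theorem coe_sum {ι : Type*} (s : Finset ι) (c : ι → ℝ) :
    ((∑ i ∈ s, c i : ℝ) : EReal) = ∑ i ∈ s, (c i : EReal) := by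
  classical
  induction s using Finset.induction_on with
  | empty => simp
  | insert i s hi ih => rw [Finset.sum_insert hi, Finset.sum_insert hi, EReal.coe_add, ih]

theorem IsPLQ.sum {ι : Type*} (s : Finset ι) {θ : ι → F → EReal} (h : ∀ i, IsPLQ (θ i)) :
    IsPLQ (fun y => ∑ i ∈ s, θ i y) := by
  classical
  induction s using Finset.induction_on with
  | empty => simpa using IsPLQ.zero
  | insert i s hi ih =>
    simp only [Finset.sum_insert hi]
    exact (h i).add ih

theorem mem_dom_sum {X ι : Type*} [Fintype ι] {θ : ι → X → EReal}
    (hb : ∀ i y, θ i y ≠ ⊥) {y : X} :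
    y ∈ dom (fun y => ∑ i, θ i y) ↔ ∀ i, y ∈ dom (θ i) := by
  have := sum_lt_top_iff Finset.univ (fun i => θ i y) (fun i _ => hb i y)
  simpa [dom] using this

theorem toReal_sum_of_mem_dom {X ι : Type*} [Fintype ι] {θ : ι → X → EReal}
    (hb : ∀ i y, θ i y ≠ ⊥) {y : X} (hy : ∀ i, y ∈ dom (θ i)) :
    (∑ i, θ i y).toReal = ∑ i, (θ i y).toReal := by
  have : ∑ i, θ i y = ((∑ i, (θ i y).toReal : ℝ) : EReal) := by
    rw [coe_sum]
    exact Finset.sum_congr rfl fun i _ => (coe_toReal_of_mem_dom (hb i) (hy i)).symm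
  rw [this, EReal.toReal_coe]

theorem convexOn_sum_toReal {ι : Type*} [Fintype ι] {θ : ι → F → EReal}
    (hb : ∀ i y, θ i y ≠ ⊥) (hc : ∀ i, ConvexOn ℝ (dom (θ i)) (fun y => (θ i y).toReal)) :
    ConvexOn ℝ (dom fun y => ∑ i, θ i y) (fun y => (∑ i, θ i y).toReal) := by
  have hD : Convex ℝ (dom fun y => ∑ i, θ i y) := by
    intro x hx y hy a b ha hb' hab
    rw [mem_dom_sum hb] at hx hy ⊢
    exact fun i => (hc i).1 (hx i) (hy i) ha hb' hab
  refine ⟨hD, ?_⟩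
  intro x hx y hy a b ha hb' hab
  have h3 := hD hx hy ha hb' hab
  rw [mem_dom_sum hb] at hx hy h3
  change (∑ i, θ i (a • x + b • y)).toReal ≤
    a • (∑ i, θ i x).toReal + b • (∑ i, θ i y).toReal
  rw [toReal_sum_of_mem_dom hb hx, toReal_sum_of_mem_dom hb hy, toReal_sum_of_mem_dom hb h3,
    Finset.smul_sum, Finset.smul_sum, ← Finset.sum_add_distrib]
  exact Finset.sum_le_sum fun i _ => (hc i).2 (hx i) (hy i) ha hb' hab

/-! ### Directional behaviour of polyhedral sets and piecewise linear-quadratic functions -/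

theorem tendsto_add_smul (y z : F) :
    Tendsto (fun p : ℝ × F => y + p.1 • p.2) (𝓝[>] (0 : ℝ) ×ˢ 𝓝 z) (𝓝 y) := by
  have h : Tendsto (fun p : ℝ × F => y + p.1 • p.2) (𝓝 ((0 : ℝ), z)) (𝓝 (y + (0 : ℝ) • z)) :=
    (by fun_prop : Continuous fun p : ℝ × F => y + p.1 • p.2).tendsto _
  rw [zero_smul, add_zero, nhds_prod_eq] at h
  exact h.mono_left (Filter.prod_mono nhdsWithin_le_nhds le_rfl)

theorem eventually_pos_prod {α : Type*} (l : Filter α) :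
    ∀ᶠ p : ℝ × α in 𝓝[>] (0 : ℝ) ×ˢ l, 0 < p.1 :=
  tendsto_fst.eventually (eventually_mem_of_tendsto_nhdsWithin tendsto_id)

/-- A direction that strictly violates an active constraint does so together with all nearby
directions, for every positive step. If it violates none, the inactive constraints stay slack for
short steps. Uniformity in nearby directions is what the lower limits require. -/
theorem IsPolyhedral.direction {Ω : Set F} (h : IsPolyhedral Ω) (y z : F) :
    (∃ s₀ : ℝ, 0 < s₀ ∧ ∀ s : ℝ, 0 ≤ s → s ≤ s₀ → y + s • z ∈ Ω) ∨
      ∀ᶠ p : ℝ × F in 𝓝[>] (0 : ℝ) ×ˢ 𝓝 z, y + p.1 • p.2 ∉ Ω := by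
  by_cases hy : y ∈ Ω
  swap
  · exact Or.inr ((tendsto_add_smul y z).eventually (h.isClosed.isOpen_compl.mem_nhds hy))
  have hcv := h.convex
  obtain ⟨k, b, β, rfl⟩ := h
  by_cases hj : ∃ j, inner ℝ (b j) y = β j ∧ 0 < inner ℝ (b j) z
  · obtain ⟨j, hj1, hj2⟩ := hj
    right
    have h1 : ∀ᶠ z' in 𝓝 z, 0 < inner ℝ (b j) z' :=
      (by fun_prop : Continuous fun z' : F => inner ℝ (b j) z').continuousAt.eventually_const_lt hj2
    filter_upwards [eventually_pos_prod (𝓝 z), tendsto_snd.eventually h1] with p hp1 hp2 hp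
    have := hp j
    rw [inner_add_right, inner_smul_right, hj1] at this
    nlinarith [mul_pos hp1 hp2]
  · left
    push Not at hj
    have h2 : ∀ᶠ s in 𝓝[>] (0 : ℝ), ∀ j, inner ℝ (b j) (y + s • z) ≤ β j := by
      rw [eventually_all]
      intro j
      rcases (hy j).lt_or_eq with hlt | heq
      · have hc : Continuous fun s : ℝ => inner ℝ (b j) (y + s • z) := by fun_prop
        have : ∀ᶠ s in 𝓝 (0 : ℝ), inner ℝ (b j) (y + s • z) < β j :=
          hc.continuousAt.eventually_lt_const (by simpa using hlt)
        exact (this.filter_mono nhdsWithin_le_nhds).mono fun s hs => hs.le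
      · filter_upwards [self_mem_nhdsWithin] with s hs
        have hs' : (0 : ℝ) < s := hs
        rw [inner_add_right, inner_smul_right, heq]
        nlinarith [hj j heq]
    obtain ⟨s₀, hs₀, hs₁⟩ := (h2.and self_mem_nhdsWithin).exists
    have hs₁' : (0 : ℝ) < s₀ := hs₁
    refine ⟨s₀, hs₁', fun s hs hs' => ?_⟩
    have h3 := hcv hy hs₀ (a := 1 - s / s₀) (b := s / s₀)
      (by rw [sub_nonneg, div_le_one hs₁']; exact hs') (by positivity) (by ring)
    have e : (1 - s / s₀) • y + (s / s₀) • (y + s₀ • z) = y + s • z := by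
      rw [smul_add, smul_smul, div_mul_cancel₀ _ hs₁'.ne', ← add_assoc, ← add_smul]
      simp
    rwa [e] at h3

/-- A linear-quadratic function along a ray. -/
theorem quadratic_add_smul {A : F →ₗ[ℝ] F} (hA : A.IsSymmetric) (a : F) (α : ℝ) (y z : F) (t : ℝ) :
    1 / 2 * inner ℝ (A (y + t • z)) (y + t • z) + inner ℝ a (y + t • z) + α =
      (1 / 2 * inner ℝ (A y) y + inner ℝ a y + α) + t * inner ℝ (A y + a) z +
        t ^ 2 / 2 * inner ℝ (A z) z := by
  have h1 : inner ℝ (A z) y = inner ℝ (A y) z := by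
    rw [hA z y, real_inner_comm]
  simp only [map_add, map_smul, inner_add_left, inner_add_right, inner_smul_left,
    inner_smul_right, h1, RCLike.conj_to_real]
  ring

/-- Along a given direction, a convex piecewise linear-quadratic function either is infinite
near that direction, or is linear-quadratic along it, with second-order lower estimates
relative to subgradients near it. -/
theorem IsPLQ.ray [FiniteDimensional ℝ F] {θ : F → EReal} (h : IsPLQ θ) (y z : F) :
    (∀ᶠ p : ℝ × F in 𝓝[>] (0 : ℝ) ×ˢ 𝓝 z, y + p.1 • p.2 ∉ dom θ) ∨
    ∃ g q s₀ : ℝ, 0 < s₀ ∧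
      (∀ s : ℝ, 0 ≤ s → s ≤ s₀ → y + s • z ∈ dom θ ∧
        (θ (y + s • z)).toReal = (θ y).toReal + s * g + s ^ 2 / 2 * q) ∧
      ∀ l, IsSubgradient θ y l → ∀ M : ℝ, (inner ℝ l z < g ∨ M < q) →
        ∀ᶠ p : ℝ × F in 𝓝[>] (0 : ℝ) ×ˢ 𝓝 z,
          (((θ y).toReal + p.1 * inner ℝ l p.2 + p.1 ^ 2 / 2 * M : ℝ) : EReal) ≤
            θ (y + p.1 • p.2) := by
  obtain ⟨k, Ω, A, a, α, hΩ, hA, hd, hq⟩ := h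
  have hsub : ∀ i, ∀ x ∈ Ω i, x ∈ dom θ := fun i x hx => by
    rw [hd]; exact Set.mem_iUnion.2 ⟨i, hx⟩
  have hval : ∀ i, ∀ x ∈ Ω i,
      (θ x).toReal = 1 / 2 * inner ℝ (A i x) x + inner ℝ (a i) x + α i := fun i x hx => by
    rw [hq i x hx, EReal.toReal_coe]
  have hexp : ∀ i, y ∈ Ω i → ∀ (z : F) (t : ℝ), y + t • z ∈ Ω i →
      (θ (y + t • z)).toReal = (θ y).toReal + t * inner ℝ (A i y + a i) z +
        t ^ 2 / 2 * inner ℝ (A i z) z := fun i hy z t hz => by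
    rw [hval i _ hz, hval i _ hy, quadratic_add_smul (hA i)]
  -- If no piece contains an initial segment of the ray, then all of them, being finitely many, are
  -- missed by all nearby directions and short steps.
  by_cases hI : ∃ i, ∃ s₀ : ℝ, 0 < s₀ ∧ ∀ s : ℝ, 0 ≤ s → s ≤ s₀ → y + s • z ∈ Ω i
  swap
  · left
    have : ∀ᶠ p : ℝ × F in 𝓝[>] (0 : ℝ) ×ˢ 𝓝 z, ∀ i, y + p.1 • p.2 ∉ Ω i := by
      rw [eventually_all]
      intro i
      rcases (hΩ i).direction y z with h | h
      · exact absurd ⟨i, h⟩ hI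
      · exact h
    filter_upwards [this] with p hp
    rw [hd]
    simpa using hp
  right
  obtain ⟨i₀, s₀, hs₀, hray⟩ := hI
  have hy₀ : y ∈ Ω i₀ := by simpa using hray 0 le_rfl hs₀.le
  refine ⟨inner ℝ (A i₀ y + a i₀) z, inner ℝ (A i₀ z) z, s₀, hs₀,
    fun s hs hs' => ⟨hsub i₀ _ (hray s hs hs'), hexp i₀ hy₀ z s (hray s hs hs')⟩, ?_⟩
  intro l hl M hM
  have key : ∀ j, ∀ᶠ p : ℝ × F in 𝓝[>] (0 : ℝ) ×ˢ 𝓝 z, y + p.1 • p.2 ∈ Ω j →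
      (θ y).toReal + p.1 * inner ℝ l p.2 + p.1 ^ 2 / 2 * M ≤ (θ (y + p.1 • p.2)).toReal := by
    intro j
    rcases (hΩ j).direction y z with ⟨s₁, hs₁, hray'⟩ | h
    swap
    · exact h.mono fun p hp hp' => absurd hp' hp
    have hyj : y ∈ Ω j := by simpa using hray' 0 le_rfl hs₁.le
    -- Two quadratics that agree on an initial segment of the ray have the same slope and curvature
    -- there; comparing at two step lengths separates the two coefficients.
    obtain ⟨hg, hQ⟩ : inner ℝ (A j y + a j) z = inner ℝ (A i₀ y + a i₀) z ∧
        inner ℝ (A j z) z = inner ℝ (A i₀ z) z := by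
      have hσ : 0 < min s₀ s₁ := lt_min hs₀ hs₁
      have hcoef : ∀ s : ℝ, 0 < s → s ≤ min s₀ s₁ →
          inner ℝ (A j y + a j) z + s / 2 * inner ℝ (A j z) z =
            inner ℝ (A i₀ y + a i₀) z + s / 2 * inner ℝ (A i₀ z) z := by
        intro s hs hs'
        have e1 := hexp i₀ hy₀ z s (hray s hs.le (hs'.trans (min_le_left _ _)))
        have e2 := hexp j hyj z s (hray' s hs.le (hs'.trans (min_le_right _ _)))
        refine mul_left_cancel₀ hs.ne' ?_
        linear_combination e1 - e2
      have e1 := hcoef _ hσ le_rfl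
      have e2 := hcoef _ (half_pos hσ) (half_le_self hσ.le)
      have hQ : inner ℝ (A j z) z = inner ℝ (A i₀ z) z := by
        refine mul_left_cancel₀ hσ.ne' ?_
        linear_combination 4 * e1 - 4 * e2
      exact ⟨by rw [hQ] at e1; linarith, hQ⟩
    have hcA : Continuous (A j) := (A j).continuous_of_finiteDimensional
    -- The subgradient inequality along the segment, divided by the step, bounds the slope in the
    -- perturbed direction `p.2` itself and not only in `z`.
    have hslope : ∀ p : ℝ × F, 0 < p.1 → y + p.1 • p.2 ∈ Ω j →
        inner ℝ l p.2 ≤ inner ℝ (A j y + a j) p.2 := by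
      intro p hp hp'
      have hlim : Tendsto (fun s : ℝ => inner ℝ (A j y + a j) p.2 +
          s * p.1 / 2 * inner ℝ (A j p.2) p.2) (𝓝[>] 0) (𝓝 (inner ℝ (A j y + a j) p.2)) := by
        have hc : Continuous (fun s : ℝ => inner ℝ (A j y + a j) p.2 +
          s * p.1 / 2 * inner ℝ (A j p.2) p.2) := by fun_prop
        have := hc.tendsto 0
        simp only [zero_mul, zero_div, add_zero] at this
        exact this.mono_left nhdsWithin_le_nhds
      refine ge_of_tendsto hlim ?_
      filter_upwards [Ioo_mem_nhdsGT (zero_lt_one' ℝ)] with s hs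
      have h1 : y + (s * p.1) • p.2 ∈ Ω j := by
        have := (hΩ j).convex hyj hp' (a := 1 - s) (b := s) (by linarith [hs.2]) hs.1.le (by ring)
        have e : (1 - s) • y + s • (y + p.1 • p.2) = y + (s * p.1) • p.2 := by
          rw [smul_add, smul_smul, ← add_assoc, ← add_smul]
          simp
        rwa [e] at this
      have h2 := hl _ (hsub j _ h1)
      rw [hexp j hyj _ _ h1, add_sub_cancel_left, inner_smul_right] at h2
      have h3 : 0 < s * p.1 := mul_pos hs.1 hp
      by_contra hcon
      push Not at hcon
      nlinarith [mul_pos h3 (sub_pos.2 hcon)]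
    -- A strict gap in slope absorbs any second-order term for short steps. If only `M < q` is
    -- known, `hslope` handles the first order and continuity of the curvature the second.
    rcases hM with hM | hM
    · have hc : Continuous fun p : ℝ × F => inner ℝ (A j y + a j) p.2 - inner ℝ l p.2 +
          p.1 / 2 * (inner ℝ (A j p.2) p.2 - M) := by fun_prop
      have h1 := (hc.tendsto ((0 : ℝ), z)).eventually_const_lt
        (u := 0) (by simp only [zero_div, zero_mul, add_zero]; rw [hg]; linarith)
      rw [nhds_prod_eq] at h1
      filter_upwards [h1.filter_mono (Filter.prod_mono nhdsWithin_le_nhds le_rfl),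
        eventually_pos_prod (𝓝 z)] with p hp1 hp2 hp3
      rw [hexp j hyj _ _ hp3]
      nlinarith [mul_pos hp2 hp1]
    · have hc : Continuous fun z' : F => inner ℝ (A j z') z' := by fun_prop
      have h1 := (hc.tendsto z).eventually_const_lt (u := M) (by rw [hQ]; exact hM)
      filter_upwards [tendsto_snd.eventually h1, eventually_pos_prod (𝓝 z)] with p hp1 hp2 hp3
      rw [hexp j hyj _ _ hp3]
      have := hslope p hp2 hp3
      nlinarith [mul_le_mul_of_nonneg_left this hp2.le, mul_pos hp2 hp2]
  filter_upwards [eventually_all.2 key] with p hp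
  by_cases hpd : y + p.1 • p.2 ∈ dom θ
  · have hpd' := hpd
    rw [hd] at hpd'
    obtain ⟨j, hj⟩ := Set.mem_iUnion.1 hpd'
    have := hp j hj
    rw [hval j _ hj] at this
    rw [hq j _ hj]
    exact_mod_cast this
  · rw [eq_top_of_notMem_dom hpd]
    exact le_top

theorem exists_lipschitz_quadratic [FiniteDimensional ℝ F] (A : F →ₗ[ℝ] F) (a : F) (α : ℝ) (y : F) :
    ∃ C : ℝ, 0 ≤ C ∧ ∃ ρ : ℝ, 0 < ρ ∧ ∀ u ∈ Metric.ball y ρ, ∀ u' ∈ Metric.ball y ρ,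
      |(1 / 2 * inner ℝ (A u) u + inner ℝ a u + α) -
        (1 / 2 * inner ℝ (A u') u' + inner ℝ a u' + α)| ≤ C * ‖u - u'‖ := by
  let A' : F →L[ℝ] F := LinearMap.toContinuousLinearMap A
  have hc : ContDiff ℝ 1 (fun u : F => 1 / 2 * inner ℝ (A' u) u + inner ℝ a u + α) :=
    ((contDiff_const.mul (A'.contDiff.inner ℝ contDiff_id)).add
      (contDiff_const.inner ℝ contDiff_id)).add contDiff_const
  obtain ⟨K, t, ht, hK⟩ := hc.contDiffAt.exists_lipschitzOnWith (x := y)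
  obtain ⟨ρ, hρ, hρt⟩ := Metric.mem_nhds_iff.1 ht
  refine ⟨K, K.2, ρ, hρ, fun u hu u' hu' => ?_⟩
  have := hK.dist_le_mul u (hρt hu) u' (hρt hu')
  rwa [Real.dist_eq, dist_eq_norm] at this

/-- A convex piecewise linear-quadratic function is locally Lipschitz relative to its domain. -/
theorem IsPLQ.exists_lipschitz [FiniteDimensional ℝ F] {θ : F → EReal} (h : IsPLQ θ)
    (hc : IsConvexFun θ) (y : F) :
    ∃ C : ℝ, 0 ≤ C ∧ ∃ ρ : ℝ, 0 < ρ ∧ ∀ u ∈ Metric.ball y ρ, ∀ u' ∈ Metric.ball y ρ,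
      u ∈ dom θ → u' ∈ dom θ → |(θ u).toReal - (θ u').toReal| ≤ C * ‖u - u'‖ := by
  rw [isConvexFun_iff h.ne_bot] at hc
  obtain ⟨k, Ω, A, a, α, hΩ, hA, hd, hq⟩ := h
  choose C hC0 ρ hρ hC using fun i => exists_lipschitz_quadratic (A i) (a i) (α i) y
  have hCle : ∀ i, C i ≤ ∑ j, C j := fun i =>
    Finset.single_le_sum (fun j _ => hC0 j) (Finset.mem_univ i)
  obtain ⟨r, hr, hrρ⟩ : ∃ r : ℝ, 0 < r ∧ ∀ i, r ≤ ρ i := by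
    have : ∀ᶠ r in 𝓝[>] (0 : ℝ), ∀ i, r ≤ ρ i := by
      rw [eventually_all]
      exact fun i => Filter.mem_of_superset (Ioo_mem_nhdsGT (hρ i)) fun r hr => hr.2.le
    obtain ⟨r, h1, h2⟩ := (this.and self_mem_nhdsWithin).exists
    exact ⟨r, h2, h1⟩
  refine ⟨∑ j, C j, Finset.sum_nonneg fun j _ => hC0 j, r, hr, ?_⟩
  have main : ∀ u ∈ Metric.ball y r, ∀ u' ∈ Metric.ball y r, u ∈ dom θ → u' ∈ dom θ →
      (θ u).toReal - (θ u').toReal ≤ (∑ j, C j) * ‖u - u'‖ := by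
    intro u hu u' hu' hud hud'
    have hseg : ∀ s : ℝ, 0 ≤ s → s ≤ 1 → (1 - s) • u + s • u' = u + s • (u' - u) := by
      intro s _ _
      rw [smul_sub, sub_smul, one_smul]; abel
    -- By convexity the segment lies in the domain, so a single piece contains an initial part of
    -- it. The Lipschitz bound on that part extends to the whole segment because convex slopes
    -- increase.
    obtain ⟨i, s₀, hs₀, hi⟩ :
        ∃ i, ∃ s₀ : ℝ, 0 < s₀ ∧ ∀ s : ℝ, 0 ≤ s → s ≤ s₀ → u + s • (u' - u) ∈ Ω i := by
      by_contra hcon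
      have h1 : ∀ᶠ p : ℝ × F in 𝓝[>] (0 : ℝ) ×ˢ 𝓝 (u' - u), ∀ i, u + p.1 • p.2 ∉ Ω i := by
        rw [eventually_all]
        intro i
        rcases (hΩ i).direction u (u' - u) with h | h
        · exact absurd ⟨i, h⟩ hcon
        · exact h
      have h2 : ∀ᶠ s in 𝓝[>] (0 : ℝ), ∀ i, u + s • (u' - u) ∉ Ω i :=
        (tendsto_id.prodMk (tendsto_const_nhds (x := u' - u))).eventually h1
      obtain ⟨s, hs, hs'⟩ := (h2.and (Ioo_mem_nhdsGT (zero_lt_one' ℝ))).exists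
      have h3 := hc.1 hud hud' (sub_nonneg.2 hs'.2.le) hs'.1.le (sub_add_cancel 1 s)
      rw [hseg s hs'.1.le hs'.2.le, hd] at h3
      obtain ⟨i, hi⟩ := Set.mem_iUnion.1 h3
      exact hs i hi
    set s := min s₀ 1 with hs
    have hs0 : 0 < s := lt_min hs₀ one_pos
    have hs1 : s ≤ 1 := min_le_right _ _
    have hm := hi s hs0.le (min_le_left _ _)
    have hu0 : u ∈ Ω i := by simpa using hi 0 le_rfl hs₀.le
    have hball : u + s • (u' - u) ∈ Metric.ball y r := by
      rw [← hseg s hs0.le hs1]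
      exact (convex_ball y r) hu hu' (by linarith) hs0.le (by ring)
    have h1 := hC i u (Metric.ball_subset_ball (hrρ i) hu) _
      (Metric.ball_subset_ball (hrρ i) hball)
    have e0 : (θ u).toReal = 1 / 2 * inner ℝ (A i u) u + inner ℝ (a i) u + α i := by
      rw [hq i u hu0, EReal.toReal_coe]
    have e1 : (θ (u + s • (u' - u))).toReal = 1 / 2 * inner ℝ (A i (u + s • (u' - u)))
        (u + s • (u' - u)) + inner ℝ (a i) (u + s • (u' - u)) + α i := by
      rw [hq i _ hm, EReal.toReal_coe]
    rw [← e0, ← e1, sub_add_cancel_left, norm_neg, norm_smul, Real.norm_of_nonneg hs0.le] at h1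
    have h2 := hc.2 hud hud' (sub_nonneg.2 hs1) hs0.le (sub_add_cancel 1 s)
    rw [hseg s hs0.le hs1] at h2
    simp only [smul_eq_mul] at h2
    have h3 : s * ((θ u).toReal - (θ u').toReal) ≤ s * (C i * ‖u' - u‖) := by
      have := (abs_le.1 h1).2
      nlinarith
    have h4 := le_of_mul_le_mul_left h3 hs0
    rw [norm_sub_rev u u']
    exact h4.trans (mul_le_mul_of_nonneg_right (hCle i) (norm_nonneg _))
  intro u hu u' hu' hud hud'
  rw [abs_le]
  constructor
  · have := main u' hu' u hu hud' hud
    rw [norm_sub_rev] at this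
    linarith
  · exact main u hu u' hu' hud hud'

/-! ### A multiplier rule from the Hahn–Banach theorem -/

/-- If a linear functional `v` shifted by `δ` is bounded by the exact penalization of a convex
cone `K` along the affine map `x ↦ T x + c`, then `v` is the image under the adjoint of `T` of a
multiplier in the polar of `K`. -/
theorem exists_multiplier [FiniteDimensional ℝ F] (T : E →L[ℝ] F) (K : Set (F × ℝ))
    (hadd : ∀ p ∈ K, ∀ q ∈ K, p + q ∈ K) (hsmul : ∀ s : ℝ, 0 < s → ∀ p ∈ K, s • p ∈ K)
    (h0 : (0 : F × ℝ) ∈ K) {L : ℝ} (hL : 0 ≤ L) (c : F) (δ : ℝ) (v : E)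
    (h : ∀ p ∈ K, ∀ x : E, δ + inner ℝ v x ≤ p.2 + L * ‖T x + c - p.1‖) :
    ∃ l : F, (∀ x, inner ℝ l (T x) = inner ℝ v x) ∧ δ ≤ inner ℝ l c ∧
      ∀ p ∈ K, inner ℝ l p.1 ≤ p.2 := by
  have : CompleteSpace F := FiniteDimensional.complete ℝ F
  -- `A` is the strict epigraph of the infimal convolution of `K` with `L‖·‖`: an open convex cone,
  -- disjoint from the affine graph `B` by hypothesis. The penalty supplies openness, so `K` need
  -- not be closed.
  let A : Set (F × ℝ) := {y | ∃ p ∈ K, p.2 + L * ‖y.1 - p.1‖ < y.2}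
  let B : Set (F × ℝ) := Set.range fun x : E => (T x + c, δ + inner ℝ v x)
  have hAs : ∀ s : ℝ, 0 < s → ∀ y ∈ A, s • y ∈ A := by
    rintro s hs y ⟨p, hp, hlt⟩
    refine ⟨s • p, hsmul s hs p hp, ?_⟩
    simp only [Prod.smul_fst, Prod.smul_snd, smul_eq_mul, ← smul_sub, norm_smul,
      Real.norm_of_nonneg hs.le]
    nlinarith
  have hAa : ∀ y ∈ A, ∀ y' ∈ A, y + y' ∈ A := by
    rintro y ⟨p, hp, hlt⟩ y' ⟨p', hp', hlt'⟩
    refine ⟨p + p', hadd p hp p' hp', ?_⟩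
    have e : (y + y').1 - (p + p').1 = (y.1 - p.1) + (y'.1 - p'.1) := by
      simp only [Prod.fst_add]; abel
    have h2 : (y + y').2 = y.2 + y'.2 := rfl
    have h3 : (p + p').2 = p.2 + p'.2 := rfl
    rw [e, h2, h3]
    nlinarith [mul_le_mul_of_nonneg_left (norm_add_le (y.1 - p.1) (y'.1 - p'.1)) hL]
  have hAc : Convex ℝ A := by
    rw [convex_iff_forall_pos]
    intro y hy y' hy' a b ha hb _
    exact hAa _ (hAs a ha y hy) _ (hAs b hb y' hy')
  have hAo : IsOpen A := by
    have : A = ⋃ p ∈ K, {y : F × ℝ | p.2 + L * ‖y.1 - p.1‖ < y.2} := by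
      ext y; simp [A]
    rw [this]
    exact isOpen_biUnion fun p _ => isOpen_lt (by fun_prop) (by fun_prop)
  have hBc : Convex ℝ B := by
    rintro _ ⟨x, rfl⟩ _ ⟨x', rfl⟩ a b ha hb hab
    refine ⟨a • x + b • x', ?_⟩
    ext
    · simp only [map_add, map_smul, Prod.fst_add, Prod.smul_fst, smul_add]
      have : c = a • c + b • c := by rw [← add_smul, hab, one_smul]
      nth_rewrite 1 [this]
      abel
    · simp only [inner_add_right, inner_smul_right, Prod.snd_add, Prod.smul_snd, smul_eq_mul]
      linear_combination (-δ) * hab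
  have hdisj : Disjoint A B := by
    rw [Set.disjoint_left]
    rintro _ ⟨p, hp, hlt⟩ ⟨x, rfl⟩
    exact absurd (h p hp x) (not_le.2 hlt)
  obtain ⟨g, u, hgA, hgB⟩ := geometric_hahn_banach_open hAc hAo hBc hdisj
  let ℓ : StrongDual ℝ F := g.comp (ContinuousLinearMap.inl ℝ F ℝ)
  set β : ℝ := g (0, 1) with hβdef
  have hg : ∀ y : F, ∀ a : ℝ, g (y, a) = ℓ y + β * a := by
    intro y a
    have : (y, a) = (y, 0) + a • ((0 : F), (1 : ℝ)) := by ext <;> simp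
    rw [this, map_add, map_smul, smul_eq_mul, mul_comm]
    rfl
  -- The separating functional is not vertical: above `c` the set `A` has a point higher than the
  -- point `(c, δ)` of `B`.
  have hβ : β < 0 := by
    have h1 : ((c, max (L * ‖c‖) δ + 1) : F × ℝ) ∈ A := by
      refine ⟨0, h0, ?_⟩
      simp only [Prod.snd_zero, Prod.fst_zero, sub_zero, zero_add]
      linarith [le_max_left (L * ‖c‖) δ]
    have h2 : ((c, δ) : F × ℝ) ∈ B := ⟨0, by simp⟩
    have h3 := (hgA _ h1).trans_le (hgB _ h2)
    rw [hg, hg] at h3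
    have h4 := le_max_right (L * ‖c‖) δ
    by_contra hcon
    push Not at hcon
    nlinarith
  have hpos : ∀ s : ℝ, 0 < s → ((0, s) : F × ℝ) ∈ A := fun s hs => ⟨0, h0, by simpa using hs⟩
  have hu : 0 ≤ u := by
    by_contra hcon
    push Not at hcon
    have := hgA _ (hpos (u / (2 * β)) (div_pos_of_neg_of_neg hcon (by linarith)))
    have e : β * (u / (2 * β)) = u / 2 := by field_simp [hβ.ne]
    rw [hg, map_zero, zero_add, e] at this
    linarith
  have hA0 : ∀ y ∈ A, g y ≤ 0 := by
    intro y hy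
    by_contra hcon
    push Not at hcon
    have := hgA _ (hAs ((u + 1) / g y) (by positivity) y hy)
    rw [map_smul, smul_eq_mul, div_mul_cancel₀ _ hcon.ne'] at this
    linarith
  let l : F := (InnerProductSpace.toDual ℝ F).symm ((-β)⁻¹ • ℓ)
  have hl : ∀ y, inner ℝ l y = (-β)⁻¹ * ℓ y := fun y => by
    rw [InnerProductSpace.toDual_symm_apply]
    rfl
  have hβ' : 0 < (-β)⁻¹ := inv_pos.2 (neg_pos.2 hβ)
  have hnorm : ∀ y a, (-β)⁻¹ * g (y, a) = inner ℝ l y - a := fun y a => by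
    rw [hg, hl]
    field_simp [hβ.ne]
    ring
  have hBl : ∀ x : E, δ + inner ℝ v x ≤ inner ℝ l (T x) + inner ℝ l c := by
    intro x
    have h1 := hu.trans (hgB _ ⟨x, rfl⟩)
    have h2 := mul_nonneg hβ'.le h1
    rw [hnorm, inner_add_right] at h2
    linarith
  refine ⟨l, fun x => ?_, by simpa using hBl 0, fun p hp => ?_⟩
  -- An affine inequality on all of `E` forces equal linear parts; the multiple of `x` is chosen so
  -- that the inequality would fail by exactly 1.
  · by_contra hne
    set m := inner ℝ l (T x) - inner ℝ v x with hm
    have hm0 : m ≠ 0 := sub_ne_zero.2 hne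
    have := hBl (((δ - inner ℝ l c - 1) / m) • x)
    rw [map_smul, inner_smul_right, inner_smul_right] at this
    have h3 : (δ - inner ℝ l c - 1) / m * m = δ - inner ℝ l c - 1 := div_mul_cancel₀ _ hm0
    rw [hm, mul_sub] at h3
    rw [← hm] at h3
    linarith
  · refine le_of_forall_pos_le_add fun η hη => ?_
    have h1 : ((p.1, p.2 + η) : F × ℝ) ∈ A := ⟨p, hp, by simpa using hη⟩
    have h2 := mul_nonpos_of_nonneg_of_nonpos hβ'.le (hA0 _ h1)
    rw [hnorm] at h2
    linarith

/-- The multiplier rule for the cone generated by the epigraph of `θ`, seen from `(y, θ y)`: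
the multiplier is a subgradient of `θ` at `y`. -/
theorem exists_multiplier_of_convex [FiniteDimensional ℝ F] {θ : F → EReal}
    (hc : ConvexOn ℝ (dom θ) fun y => (θ y).toReal) {y : F} (hy : y ∈ dom θ)
    (T : E →L[ℝ] F) {L : ℝ} (hL : 0 ≤ L) (c : F) (δ : ℝ) (v : E)
    (h : ∀ y' ∈ dom θ, ∀ M : ℝ, 0 ≤ M → ∀ x : E, δ + inner ℝ v x ≤
      M * ((θ y').toReal - (θ y).toReal) + L * ‖T x + c - M • (y' - y)‖) :
    ∃ l : F, (∀ x, inner ℝ l (T x) = inner ℝ v x) ∧ δ ≤ inner ℝ l c ∧ IsSubgradient θ y l := by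
  let K : Set (F × ℝ) := {p : F × ℝ | ∃ y' ∈ dom θ, ∃ M : ℝ, 0 ≤ M ∧ p.1 = M • (y' - y) ∧
      M * ((θ y').toReal - (θ y).toReal) ≤ p.2}
  have hadd : ∀ p ∈ K, ∀ q ∈ K, p + q ∈ K := by
    rintro p ⟨y₁, hy₁, M₁, hM₁, e₁, i₁⟩ q ⟨y₂, hy₂, M₂, hM₂, e₂, i₂⟩
    -- Normalized weights turn the sum into a single multiple of a point of the domain; two zero
    -- multiples cannot be normalized.
    rcases (add_nonneg hM₁ hM₂).eq_or_lt with h0 | hpos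
    · have z1 : M₁ = 0 := by linarith
      have z2 : M₂ = 0 := by linarith
      subst z1 z2
      refine ⟨y, hy, 0, le_rfl, by simp [e₁, e₂], ?_⟩
      simp only [zero_mul, Prod.snd_add] at *
      linarith
    · have ha : 0 ≤ M₁ / (M₁ + M₂) := by positivity
      have hb : 0 ≤ M₂ / (M₁ + M₂) := by positivity
      have hab : M₁ / (M₁ + M₂) + M₂ / (M₁ + M₂) = 1 := by field_simp
      have k1 : (M₁ + M₂) * (M₁ / (M₁ + M₂)) = M₁ := by field_simp
      have k2 : (M₁ + M₂) * (M₂ / (M₁ + M₂)) = M₂ := by field_simp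
      refine ⟨_, hc.1 hy₁ hy₂ ha hb hab, M₁ + M₂, hpos.le, ?_, ?_⟩
      · rw [smul_sub, smul_add, smul_smul, smul_smul, k1, k2, add_smul, Prod.fst_add, e₁, e₂,
          smul_sub, smul_sub]
        abel
      · have := mul_le_mul_of_nonneg_left (hc.2 hy₁ hy₂ ha hb hab) hpos.le
        simp only [smul_eq_mul, mul_add, ← mul_assoc, k1, k2] at this
        rw [Prod.snd_add]
        linarith
  have hsmul : ∀ s : ℝ, 0 < s → ∀ p ∈ K, s • p ∈ K := by
    rintro s hs p ⟨y₁, hy₁, M₁, hM₁, e₁, i₁⟩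
    refine ⟨y₁, hy₁, s * M₁, by positivity, ?_, ?_⟩
    · rw [Prod.smul_fst, e₁, smul_smul]
    · rw [Prod.smul_snd, smul_eq_mul, mul_assoc]
      exact mul_le_mul_of_nonneg_left i₁ hs.le
  have h0 : (0 : F × ℝ) ∈ K := ⟨y, hy, 0, le_rfl, by simp⟩
  obtain ⟨l, h1, h2, h3⟩ := exists_multiplier T K hadd hsmul h0 hL c δ v (by
    rintro p ⟨y₁, hy₁, M₁, hM₁, e₁, i₁⟩ x
    have := h y₁ hy₁ M₁ hM₁ x
    rw [← e₁] at this
    linarith)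
  refine ⟨l, h1, h2, fun y' hy' => ?_⟩
  have := h3 (y' - y, (θ y').toReal - (θ y).toReal) ⟨y', hy', 1, by simp⟩
  simp only at this
  linarith

/-! ### Second-order expansion of a mapping that is twice differentiable at a point -/

/-- The derivative is differentiable only at `x`, so the remainder is estimated along the segment to
`x + h`: its derivative in the segment parameter is at most `ε‖h‖²`, and the mean value inequality
applies. -/
theorem TwiceDifferentiableAt.isLittleO {G : Type*} [NormedAddCommGroup G] [NormedSpace ℝ G]
    {f : E → G} {x : E} (hf : TwiceDifferentiableAt f x) :
    (fun h => f (x + h) - f x - fderiv ℝ f x h -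
      (1 / 2 : ℝ) • fderiv ℝ (fderiv ℝ f) x h h) =o[𝓝 0] fun h => ‖h‖ ^ 2 := by
  obtain ⟨hd, h2⟩ := hf
  set T := fderiv ℝ f x with hT
  set B := fderiv ℝ (fderiv ℝ f) x with hB
  rw [Asymptotics.isLittleO_iff]
  intro ε hε
  have h3 := h2.hasFDerivAt.isLittleO
  rw [Asymptotics.isLittleO_iff] at h3
  obtain ⟨r, hr, hball⟩ := Metric.eventually_nhds_iff_ball.1 (hd.and (h3 hε))
  filter_upwards [Metric.ball_mem_nhds (0 : E) hr] with h hh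
  rw [mem_ball_zero_iff] at hh
  let ψ : ℝ → G := fun s => f (x + s • h) - s • T h - (s ^ 2 / 2) • B h h
  have hin : ∀ s ∈ Set.Icc (0 : ℝ) 1, x + s • h ∈ Metric.ball x r := by
    intro s hs
    rw [mem_ball_iff_norm, add_sub_cancel_left, norm_smul, Real.norm_of_nonneg hs.1]
    calc s * ‖h‖ ≤ 1 * ‖h‖ := mul_le_mul_of_nonneg_right hs.2 (norm_nonneg _)
      _ < r := by rwa [one_mul]
  have hψ : ∀ s ∈ Set.Icc (0 : ℝ) 1, HasDerivAt ψ
      (fderiv ℝ f (x + s • h) h - T h - s • B h h) s := by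
    intro s hs
    have d1 : HasDerivAt (fun s : ℝ => x + s • h) h s := by
      simpa using ((hasDerivAt_id s).smul_const h).const_add x
    have d2 := (hball _ (hin s hs)).1.hasFDerivAt.comp_hasDerivAt s d1
    have d3 : HasDerivAt (fun s : ℝ => s • T h) (T h) s := by
      simpa using (hasDerivAt_id s).smul_const (T h)
    have d4 : HasDerivAt (fun s : ℝ => (s ^ 2 / 2) • B h h) (s • B h h) s := by
      have : HasDerivAt (fun s : ℝ => s ^ 2 / 2) s s := by
        simpa using ((hasDerivAt_id s).pow 2).div_const 2
      exact this.smul_const _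
    exact (d2.sub d3).sub d4
  have hb : ∀ s ∈ Set.Ico (0 : ℝ) 1,
      ‖fderiv ℝ f (x + s • h) h - T h - s • B h h‖ ≤ ε * ‖h‖ ^ 2 := by
    intro s hs
    have h4 := (hball _ (hin s ⟨hs.1, hs.2.le⟩)).2
    rw [add_sub_cancel_left] at h4
    have e : fderiv ℝ f (x + s • h) h - T h - s • B h h =
        (fderiv ℝ f (x + s • h) - fderiv ℝ f x - B (s • h)) h := by
      simp [hT]
    rw [e]
    refine (ContinuousLinearMap.le_opNorm _ _).trans ?_
    calc _ ≤ (ε * ‖s • h‖) * ‖h‖ := mul_le_mul_of_nonneg_right h4 (norm_nonneg _)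
      _ ≤ (ε * ‖h‖) * ‖h‖ := by
        rw [norm_smul, Real.norm_of_nonneg hs.1]
        have : s * ‖h‖ ≤ ‖h‖ := mul_le_of_le_one_left (norm_nonneg _) hs.2.le
        gcongr
      _ = ε * ‖h‖ ^ 2 := by ring
  have := norm_image_sub_le_of_norm_deriv_le_segment_01'
    (fun s hs => (hψ s hs).hasDerivWithinAt) hb
  have e : ψ 1 - ψ 0 = f (x + h) - f x - T h - (1 / 2 : ℝ) • B h h := by
    simp only [ψ]
    simp
    abel
  rw [e] at this
  rwa [Real.norm_of_nonneg (by positivity)]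

/-- The direction may vary with the step: the remainder is o(t²) uniformly over bounded directions,
and the quadratic term is continuous. -/
theorem TwiceDifferentiableAt.tendsto {G : Type*} [NormedAddCommGroup G] [NormedSpace ℝ G]
    {f : E → G} {x : E} (hf : TwiceDifferentiableAt f x) (w : E) :
    Tendsto (fun p : ℝ × E => (p.1 ^ 2 / 2)⁻¹ •
        (f (x + p.1 • p.2) - f x - p.1 • fderiv ℝ f x p.2))
      (𝓝[>] (0 : ℝ) ×ˢ 𝓝 w) (𝓝 (fderiv ℝ (fderiv ℝ f) x w w)) := by
  set T := fderiv ℝ f x with hT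
  set B := fderiv ℝ (fderiv ℝ f) x with hB
  have hB' : Tendsto (fun p : ℝ × E => B p.2 p.2) (𝓝[>] (0 : ℝ) ×ˢ 𝓝 w) (𝓝 (B w w)) := by
    have : Continuous fun u : E => B u u := by fun_prop
    exact (this.tendsto w).comp tendsto_snd
  have h0 : Tendsto (fun p : ℝ × E => p.1 • p.2) (𝓝[>] (0 : ℝ) ×ˢ 𝓝 w) (𝓝 0) := by
    simpa using tendsto_add_smul (0 : E) w
  have hO := hf.isLittleO.comp_tendsto h0
  have hrem : Tendsto (fun p : ℝ × E => (p.1 ^ 2 / 2)⁻¹ •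
      (f (x + p.1 • p.2) - f x - T (p.1 • p.2) - (1 / 2 : ℝ) • B (p.1 • p.2) (p.1 • p.2)))
      (𝓝[>] (0 : ℝ) ×ˢ 𝓝 w) (𝓝 0) := by
    rw [tendsto_zero_iff_norm_tendsto_zero, tendsto_order]
    refine ⟨fun a ha => Eventually.of_forall fun p => ha.trans_le (norm_nonneg _), fun a ha => ?_⟩
    have hw : 0 < 2 * (‖w‖ + 1) ^ 2 := by positivity
    have h1 := Asymptotics.isLittleO_iff.1 hO (half_pos (div_pos ha hw))
    have h2 : ∀ᶠ p : ℝ × E in 𝓝[>] (0 : ℝ) ×ˢ 𝓝 w, ‖p.2‖ < ‖w‖ + 1 :=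
      tendsto_snd.eventually (continuous_norm.continuousAt.eventually_lt_const (by linarith))
    filter_upwards [h1, h2, eventually_pos_prod (𝓝 w)] with p hp1 hp2 hp3
    simp only [Function.comp] at hp1
    rw [norm_smul, norm_inv, Real.norm_of_nonneg (by positivity : (0 : ℝ) ≤ p.1 ^ 2 / 2),
      inv_mul_lt_iff₀ (by positivity)]
    refine hp1.trans_lt ?_
    rw [norm_smul, norm_pow, norm_mul, norm_norm, norm_norm, Real.norm_of_nonneg hp3.le]
    have h3 : (p.1 * ‖p.2‖) ^ 2 ≤ p.1 ^ 2 * (‖w‖ + 1) ^ 2 := by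
      rw [mul_pow]
      gcongr
    calc _ ≤ a / (2 * (‖w‖ + 1) ^ 2) / 2 * (p.1 ^ 2 * (‖w‖ + 1) ^ 2) := by gcongr
      _ = p.1 ^ 2 / 4 * a := by field_simp; ring
      _ < p.1 ^ 2 / 2 * a := by nlinarith [mul_pos (mul_pos hp3 hp3) ha]
  have := hrem.add hB'
  rw [zero_add] at this
  refine this.congr' ?_
  filter_upwards [eventually_pos_prod (𝓝 w)] with p hp
  simp only [map_smul, smul_apply, smul_sub, smul_smul]
  have : (p.1 ^ 2 / 2)⁻¹ * (1 / 2 * (p.1 * p.1)) = 1 := by field_simp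
  rw [this, one_smul, sub_add_cancel]

theorem TwiceDifferentiableAt.exists_lipschitz {G : Type*} [NormedAddCommGroup G]
    [NormedSpace ℝ G] {f : E → G} {x : E} (hf : TwiceDifferentiableAt f x) :
    ∃ C : ℝ, 0 ≤ C ∧ ∃ ρ : ℝ, 0 < ρ ∧ ∀ u ∈ Metric.ball x ρ, ∀ u' ∈ Metric.ball x ρ,
      ‖f u - f u'‖ ≤ C * ‖u - u'‖ := by
  obtain ⟨hd, h2⟩ := hf
  have hs : HasStrictFDerivAt f (fderiv ℝ f x) x :=
    hasStrictFDerivAt_of_hasFDerivAt_of_continuousAt (hd.mono fun y hy => hy.hasFDerivAt)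
      h2.continuousAt
  obtain ⟨K, s, hs', hK⟩ := hs.exists_lipschitzOnWith
  obtain ⟨ρ, hρ, hρs⟩ := Metric.mem_nhds_iff.1 hs'
  refine ⟨K, K.2, ρ, hρ, fun u hu u' hu' => ?_⟩
  have := hK.dist_le_mul u (hρs hu) u' (hρs hu')
  rwa [dist_eq_norm, dist_eq_norm] at this

/-! ### Second-order difference quotients -/

/-- Clears the denominator once and for all, so that later estimates are lower bounds on `φ` with
real left-hand sides. -/
theorem le_secondQuotient_iff {φ : E → EReal} {x : E} (hx : ((φ x).toReal : EReal) = φ x)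
    (v w : E) {t : ℝ} (ht : 0 < t) (M : ℝ) :
    (M : EReal) ≤ secondQuotient φ x v t w ↔
      (((φ x).toReal + t * inner ℝ v w + t ^ 2 / 2 * M : ℝ) : EReal) ≤ φ (x + t • w) := by
  have ht2 : (0 : ℝ) < t ^ 2 / 2 := by positivity
  rw [secondQuotient, EReal.le_div_iff_mul_le (by exact_mod_cast ht2) (EReal.coe_ne_top _), ← hx,
    EReal.toReal_coe]
  generalize φ (x + t • w) = r
  induction r using EReal.rec with
  | bot =>
    simp only [EReal.bot_sub, le_bot_iff]
    rw [← EReal.coe_mul]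
    simp [-EReal.coe_mul]
  | top => rw [EReal.top_sub_coe, EReal.top_sub_coe]; simp
  | coe r =>
    rw [← EReal.coe_sub, ← EReal.coe_sub, ← EReal.coe_mul, EReal.coe_le_coe_iff,
      EReal.coe_le_coe_iff]
    constructor <;> intro h <;> nlinarith

theorem le_secondSubderivative {φ : E → EReal} {x : E} (hx : ((φ x).toReal : EReal) = φ x)
    {v w : E} {M : ℝ}
    (h : ∀ M' < M, ∀ᶠ p : ℝ × E in 𝓝[>] (0 : ℝ) ×ˢ 𝓝 w,
      (((φ x).toReal + p.1 * inner ℝ v p.2 + p.1 ^ 2 / 2 * M' : ℝ) : EReal) ≤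
        φ (x + p.1 • p.2)) :
    (M : EReal) ≤ secondSubderivative φ x v w := by
  refine EReal.ge_of_forall_gt_iff_ge.1 fun z hz => ?_
  refine le_liminf_of_le (by isBoundedDefault) ?_
  filter_upwards [h z (by exact_mod_cast hz), eventually_pos_prod (𝓝 w)] with p hp1 hp2
  exact (le_secondQuotient_iff hx v p.2 hp2 z).2 hp1

theorem eventually_of_lt_secondSubderivative {φ : E → EReal} {x : E}
    (hx : ((φ x).toReal : EReal) = φ x) {v w : E} {M : ℝ}
    (h : (M : EReal) < secondSubderivative φ x v w) :
    ∀ᶠ p : ℝ × E in 𝓝[>] (0 : ℝ) ×ˢ 𝓝 w,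
      (((φ x).toReal + p.1 * inner ℝ v p.2 + p.1 ^ 2 / 2 * M : ℝ) : EReal) ≤
        φ (x + p.1 • p.2) := by
  filter_upwards [eventually_lt_of_lt_liminf h (by isBoundedDefault), eventually_pos_prod (𝓝 w)]
    with p hp1 hp2
  exact (le_secondQuotient_iff hx v p.2 hp2 M).1 hp1.le

/-! ### Compositions: elementary estimates -/

theorem IsSubgradient.coe_le {θ : F → EReal} (hb : ∀ y, θ y ≠ ⊥) {y l : F}
    (hl : IsSubgradient θ y l) (y' : F) :
    (((θ y).toReal + inner ℝ l (y' - y) : ℝ) : EReal) ≤ θ y' := by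
  by_cases hy' : y' ∈ dom θ
  · rw [← coe_toReal_of_mem_dom hb hy']
    exact_mod_cast hl y' hy'
  · rw [eq_top_of_notMem_dom hy']
    exact le_top

/-- A second-order lower estimate for `θ` relative to `l` carries over to `θ ∘ f`. -/
theorem le_secondSubderivative_comp {φ : E → EReal} {θ : F → EReal} {f : E → F} {x : E}
    (hf : TwiceDifferentiableAt f x) (hx : ((θ (f x)).toReal : EReal) = θ (f x))
    (hφ : ∀ᶠ y in 𝓝 x, φ y = θ (f y)) {l : F} {v : E}
    (hv : ∀ u, inner ℝ l (fderiv ℝ f x u) = inner ℝ v u) (w : E) (M : ℝ)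
    (h : ∀ M' < M, ∀ᶠ p : ℝ × F in 𝓝[>] (0 : ℝ) ×ˢ 𝓝 (fderiv ℝ f x w),
      (((θ (f x)).toReal + p.1 * inner ℝ l p.2 + p.1 ^ 2 / 2 * M' : ℝ) : EReal) ≤
        θ (f x + p.1 • p.2)) :
    ((M + inner ℝ l (fderiv ℝ (fderiv ℝ f) x w w) : ℝ) : EReal) ≤
      secondSubderivative φ x v w := by
  have hφx : φ x = θ (f x) := hφ.self_of_nhds
  refine le_secondSubderivative (by rw [hφx, hx]) fun M' hM' => ?_
  set T := fderiv ℝ f x with hT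
  set c := fderiv ℝ (fderiv ℝ f) x w w with hc
  -- Half of the gap is spent on the curvature of `f`, half on that of `θ`.
  set ε := (M + inner ℝ l c - M') / 2 with hε
  have hε0 : 0 < ε := by rw [hε]; linarith
  have hR := hf.tendsto w
  rw [← hT, ← hc] at hR
  have hlR := ((by fun_prop : Continuous fun y : F => inner ℝ l y).tendsto c).comp hR
  have h1 := hlR.eventually_const_lt (u := inner ℝ l c - ε) (by linarith)
  -- The chord direction of `f` differs from `T p.2` by `p.1 / 2` times the second-order quotient,
  -- hence tends to `T w`; the estimate for `θ` is applied along it.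
  have hz : Tendsto (fun p : ℝ × E => p.1⁻¹ • (f (x + p.1 • p.2) - f x))
      (𝓝[>] (0 : ℝ) ×ˢ 𝓝 w) (𝓝 (T w)) := by
    have h2 : Tendsto (fun p : ℝ × E => p.1 / 2) (𝓝[>] (0 : ℝ) ×ˢ 𝓝 w) (𝓝 0) := by
      have : Tendsto (fun p : ℝ × E => p.1) (𝓝[>] (0 : ℝ) ×ˢ 𝓝 w) (𝓝 0) :=
        tendsto_fst.mono_right nhdsWithin_le_nhds
      simpa using this.div_const 2
    have h3 := ((T.continuous.tendsto w).comp
      (tendsto_snd (f := 𝓝[>] (0 : ℝ)) (g := 𝓝 w))).add (h2.smul hR)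
    rw [zero_smul, add_zero] at h3
    refine h3.congr' ?_
    filter_upwards [eventually_pos_prod (𝓝 w)] with p hp
    have e1 : p.1 / 2 * (p.1 ^ 2 / 2)⁻¹ = p.1⁻¹ := by field_simp
    simp only [Function.comp, smul_smul, e1]
    rw [smul_sub, smul_smul, inv_mul_cancel₀ hp.ne', one_smul]
    abel
  have h4 := ((tendsto_fst (f := 𝓝[>] (0 : ℝ)) (g := 𝓝 w)).prodMk hz).eventually
    (h (M - ε) (by linarith))
  have h5 : Tendsto (fun p : ℝ × E => x + p.1 • p.2) (𝓝[>] (0 : ℝ) ×ˢ 𝓝 w) (𝓝 x) :=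
    tendsto_add_smul x w
  filter_upwards [h1, h4, h5.eventually hφ, eventually_pos_prod (𝓝 w)] with p hp1 hp2 hp3 hp4
  rw [hp3, hφx]
  have e2 : f x + p.1 • p.1⁻¹ • (f (x + p.1 • p.2) - f x) = f (x + p.1 • p.2) := by
    rw [smul_smul, mul_inv_cancel₀ hp4.ne', one_smul, add_sub_cancel]
  simp only [e2] at hp2
  refine le_trans (EReal.coe_le_coe_iff.2 ?_) hp2
  simp only [Function.comp, inner_smul_right, inner_sub_right] at hp1 ⊢
  rw [lt_inv_mul_iff₀ (by positivity), hv] at hp1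
  have e3 : p.1 * (p.1⁻¹ * (inner ℝ l (f (x + p.1 • p.2)) - inner ℝ l (f x))) =
      inner ℝ l (f (x + p.1 • p.2)) - inner ℝ l (f x) := by
    rw [← mul_assoc, mul_inv_cancel₀ hp4.ne', one_mul]
  rw [e3]
  have e4 : p.1 ^ 2 / 2 * M' = p.1 ^ 2 / 2 * (inner ℝ l c - ε) + p.1 ^ 2 / 2 * (M - ε) := by
    rw [hε]; ring
  rw [e4]
  linarith

/-- The affine minorant given by `l` is a second-order estimate with curvature 0, so the second
subderivative is at least the real number ⟨l, f''(w, w)⟩. -/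
theorem secondSubderivative_comp_ne_bot {φ : E → EReal} {θ : F → EReal} {f : E → F} {x : E}
    (hf : TwiceDifferentiableAt f x) (hb : ∀ y, θ y ≠ ⊥) (hx : f x ∈ dom θ)
    (hφ : ∀ᶠ y in 𝓝 x, φ y = θ (f y)) {l : F} {v : E}
    (hv : ∀ u, inner ℝ l (fderiv ℝ f x u) = inner ℝ v u) (hl : IsSubgradient θ (f x) l) (w : E) :
    secondSubderivative φ x v w ≠ ⊥ := by
  refine ne_of_gt (lt_of_lt_of_le (EReal.bot_lt_coe _)
    (le_secondSubderivative_comp hf (coe_toReal_of_mem_dom hb hx) hφ hv w 0 fun M' hM' => ?_))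
  refine Eventually.of_forall fun p => le_trans (EReal.coe_le_coe_iff.2 ?_)
    (hl.coe_le hb (f x + p.1 • p.2))
  rw [add_sub_cancel_left, inner_smul_right]
  nlinarith [sq_nonneg p.1]

/-- Subgradients of `θ` at `f x` are mapped by the adjoint derivative to limiting subgradients
of `θ ∘ f` at `x`. -/
theorem mem_limitingSubdifferential_comp {φ : E → EReal} {θ : F → EReal} {f : E → F} {x : E}
    (hf : DifferentiableAt ℝ f x) (hb : ∀ y, θ y ≠ ⊥) (hx : f x ∈ dom θ)
    (hφ : ∀ᶠ y in 𝓝 x, φ y = θ (f y)) {l : F} {v : E}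
    (hv : ∀ u, inner ℝ l (fderiv ℝ f x u) = inner ℝ v u) (hl : IsSubgradient θ (f x) l) :
    v ∈ limitingSubdifferential φ x := by
  have hφx : φ x = θ (f x) := hφ.self_of_nhds
  have hmem : WithLp.toLp 2 (x, (φ x).toReal) ∈ epi φ := by
    change φ x ≤ (((φ x).toReal : ℝ) : EReal)
    rw [hφx, coe_toReal_of_mem_dom hb hx]
  -- Constant sequences suffice, since `(v, -1)` is even a regular normal.
  refine ⟨hmem, fun _ => _, fun _ => _, fun _ => hmem, tendsto_const_nhds, tendsto_const_nhds,
    fun _ => ?_⟩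
  intro ε hε
  have h1 := hf.hasFDerivAt.isLittleO
  rw [Asymptotics.isLittleO_iff] at h1
  have h2 := (h1 (by positivity : 0 < ε / (‖l‖ + 1))).and hφ
  have h3 : Tendsto (fun y : WithLp 2 (E × ℝ) => y.fst)
      (𝓝 (WithLp.toLp 2 (x, (φ x).toReal))) (𝓝 x) :=
    (by fun_prop : Continuous fun y : WithLp 2 (E × ℝ) => y.fst).tendsto _
  filter_upwards [nhdsWithin_le_nhds (h3.eventually h2), self_mem_nhdsWithin] with y hy hye
  obtain ⟨hy1, hy2⟩ := hy
  have h4 : (((θ (f x)).toReal + inner ℝ l (f y.fst - f x) : ℝ) : EReal) ≤ (y.snd : EReal) := by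
    refine (hl.coe_le hb (f y.fst)).trans ?_
    rw [← hy2]
    exact hye
  have h5 := EReal.coe_le_coe_iff.1 h4
  have h6 : ‖y.fst - x‖ ≤ ‖y - WithLp.toLp 2 (x, (φ x).toReal)‖ :=
    WithLp.norm_fst_le _ (y - WithLp.toLp 2 (x, (φ x).toReal))
  have h7 := abs_real_inner_le_norm l (f y.fst - f x - fderiv ℝ f x (y.fst - x))
  rw [inner_sub_right, hv] at h7
  have h8 := (abs_le.1 h7).1
  have h9 : ‖l‖ * ‖f y.fst - f x - fderiv ℝ f x (y.fst - x)‖ ≤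
      ε * ‖y - WithLp.toLp 2 (x, (φ x).toReal)‖ := by
    calc _ ≤ ‖l‖ * (ε / (‖l‖ + 1) * ‖y.fst - x‖) := by gcongr
      _ = ‖l‖ / (‖l‖ + 1) * (ε * ‖y.fst - x‖) := by ring
      _ ≤ 1 * (ε * ‖y.fst - x‖) := by
        gcongr
        rw [div_le_one (by positivity)]
        linarith
      _ ≤ _ := by rw [one_mul]; gcongr
  rw [WithLp.prod_inner_apply]
  change inner ℝ v (y.fst - x) + inner ℝ (-1 : ℝ) (y.snd - (φ x).toReal) ≤ _
  have h10 : inner ℝ (-1 : ℝ) (y.snd - (φ x).toReal) = -(y.snd - (φ x).toReal) := by simp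
  rw [h10, hφx]
  rw [hφx] at h9
  linarith

/-! ### Compositions: consequences of the metric subregularity qualification condition -/

/-- Points near `x` can be corrected so that `f` maps them into `dom θ`, at a cost that is
proportional to the distance to a prescribed point of `dom θ`, both in the variable and in the
value of `θ ∘ f`. -/
theorem MSQC.exists_correction [FiniteDimensional ℝ F] {φ : E → EReal} {θ : F → EReal}
    {f : E → F} {x : E}
    (hm : MSQC θ f x) (hf : TwiceDifferentiableAt f x) (hc : IsConvexFun θ) (hp : IsPLQ θ)
    (hx : f x ∈ dom θ) (hφ : ∀ᶠ y in 𝓝 x, φ y = θ (f y)) :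
    ∃ C : ℝ, 0 ≤ C ∧ ∃ ρ : ℝ, 0 < ρ ∧
      (∀ y ∈ dom θ, ∀ y' ∈ dom θ, y ∈ Metric.ball (f x) ρ → y' ∈ Metric.ball (f x) ρ →
        |(θ y).toReal - (θ y').toReal| ≤ C * ‖y - y'‖) ∧
      ∀ u ∈ Metric.ball x ρ, ∀ y ∈ dom θ, y ∈ Metric.ball (f x) ρ → ∀ η : ℝ, 0 < η → η < ρ →
        ∃ u', f u' ∈ dom θ ∧ φ u' = θ (f u') ∧ ‖u' - u‖ ≤ C * (‖f u - y‖ + η) ∧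
          |(θ (f u')).toReal - (θ y).toReal| ≤ C * (‖f u - y‖ + η) := by
  obtain ⟨κ, hκ, hm⟩ := hm
  obtain ⟨Cf, hCf, ρf, hρf, hfl⟩ := hf.exists_lipschitz
  obtain ⟨Cθ, hCθ, ρθ, hρθ, hθl⟩ := hp.exists_lipschitz hc (f x)
  have hfc : ContinuousAt f x := hf.1.self_of_nhds.continuousAt
  obtain ⟨ρ₁, hρ₁, hball⟩ := Metric.eventually_nhds_iff_ball.1
    ((hm.and hφ).and (hfc.eventually (Metric.ball_mem_nhds (f x) hρθ)))
  set R := min (min ρf ρθ) ρ₁ with hR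
  have hR0 : 0 < R := lt_min (lt_min hρf hρθ) hρ₁
  have hRf : R ≤ ρf := (min_le_left _ _).trans (min_le_left _ _)
  have hRθ : R ≤ ρθ := (min_le_left _ _).trans (min_le_right _ _)
  have hR1 : R ≤ ρ₁ := min_le_right _ _
  -- Chosen so that the corrected point, displaced by less than `κ * d + η`, stays in the ball of
  -- radius `R`.
  set D := κ * (Cf + 1) + 2 with hD
  have hD1 : 1 ≤ D := by
    have : 0 ≤ κ * (Cf + 1) := by positivity
    linarith
  have hρ0 : 0 < R / D := by positivity
  have hρR : R / D ≤ R := div_le_self hR0.le hD1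
  have hCC : 0 ≤ Cθ * (Cf * (κ + 1)) := by positivity
  refine ⟨(κ + 1) + Cθ * (Cf * (κ + 1) + 1), by positivity, R / D, hρ0, ?_, ?_⟩
  · intro y hy y' hy' hyb hyb'
    refine (hθl y (Metric.ball_subset_ball (hρR.trans hRθ) hyb) y'
      (Metric.ball_subset_ball (hρR.trans hRθ) hyb') hy hy').trans ?_
    gcongr
    nlinarith
  intro u hu y hy hyb η hη hηρ
  have hu1 : u ∈ Metric.ball x ρ₁ := Metric.ball_subset_ball (hρR.trans hR1) hu
  have hx1 : x ∈ Metric.ball x ρf := Metric.mem_ball_self hρf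
  have huf : u ∈ Metric.ball x ρf := Metric.ball_subset_ball (hρR.trans hRf) hu
  set d := ‖f u - y‖ with hd
  have hd0 : 0 ≤ d := norm_nonneg _
  have hS : ({z | f z ∈ dom θ} : Set E).Nonempty := ⟨x, hx⟩
  have h1 : Metric.infDist u {z | f z ∈ dom θ} < κ * d + η := by
    have h2 : Metric.infDist (f u) (dom θ) ≤ d := by
      rw [hd, ← dist_eq_norm]
      exact Metric.infDist_le_dist_of_mem hy
    have := mul_le_mul_of_nonneg_left h2 hκ
    linarith [(hball u hu1).1.1]
  obtain ⟨u', hu', hdist⟩ := (Metric.infDist_lt_iff hS).1 h1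
  rw [dist_eq_norm, norm_sub_rev] at hdist
  have hd1 : d ≤ (Cf + 1) * (R / D) := by
    have h3 := hfl u huf x hx1
    rw [mem_ball_iff_norm] at hu hyb
    have h4 : d ≤ ‖f u - f x‖ + ‖y - f x‖ := by
      have e : f u - y = (f u - f x) - (y - f x) := by abel
      rw [hd, e]
      exact norm_sub_le _ _
    nlinarith [mul_le_mul_of_nonneg_left hu.le hCf]
  have hu'R : u' ∈ Metric.ball x R := by
    rw [mem_ball_iff_norm] at hu ⊢
    have h5 : ‖u' - x‖ ≤ ‖u' - u‖ + ‖u - x‖ := by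
      have e : u' - x = (u' - u) + (u - x) := by abel
      rw [e]
      exact norm_add_le _ _
    have h6 : κ * d ≤ κ * ((Cf + 1) * (R / D)) := mul_le_mul_of_nonneg_left hd1 hκ
    have h7 : D * (R / D) = R := by field_simp
    have h8 : D * (R / D) = κ * ((Cf + 1) * (R / D)) + 2 * (R / D) := by rw [hD]; ring
    linarith
  have hu'1 := hball u' (Metric.ball_subset_ball hR1 hu'R)
  have h9 : ‖u' - u‖ ≤ (κ + 1) * (d + η) := by nlinarith
  refine ⟨u', hu', hu'1.1.2, h9.trans ?_, ?_⟩
  · have : 0 ≤ Cθ * (Cf * (κ + 1) + 1) := by positivity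
    exact mul_le_mul_of_nonneg_right (by linarith) (by positivity)
  · have h10 := hθl _ hu'1.2 y (Metric.ball_subset_ball (hρR.trans hRθ) hyb) hu' hy
    have h11 : ‖f u' - y‖ ≤ (Cf * (κ + 1) + 1) * (d + η) := by
      have e : f u' - y = (f u' - f u) + (f u - y) := by abel
      have h12 := hfl u' (Metric.ball_subset_ball hRf hu'R) u huf
      have h13 := norm_add_le (f u' - f u) (f u - y)
      rw [← e] at h13
      nlinarith [mul_le_mul_of_nonneg_left h9 hCf]
    calc _ ≤ Cθ * ((Cf * (κ + 1) + 1) * (d + η)) := h10.trans (by gcongr)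
      _ ≤ _ := by nlinarith [mul_nonneg hκ hd0, mul_nonneg hκ hη.le]

theorem ConvexOn.add_smul_mem_and_le {D : Set F} {h : F → ℝ} (hc : ConvexOn ℝ D h) {y y' : F}
    (hy : y ∈ D) (hy' : y' ∈ D) {s : ℝ} (hs : 0 ≤ s) (hs1 : s ≤ 1) :
    y + s • (y' - y) ∈ D ∧ h (y + s • (y' - y)) ≤ h y + s * (h y' - h y) := by
  have e : (1 - s) • y + s • y' = y + s • (y' - y) := by
    rw [smul_sub, sub_smul, one_smul]; abel
  have h1 := hc.1 hy hy' (sub_nonneg.2 hs1) hs (sub_add_cancel 1 s)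
  have h2 := hc.2 hy hy' (sub_nonneg.2 hs1) hs (sub_add_cancel 1 s)
  rw [e] at h1 h2
  refine ⟨h1, h2.trans (le_of_eq ?_)⟩
  simp only [smul_eq_mul]
  ring

theorem tendsto_nhdsGT_zero {G : Type*} [TopologicalSpace G] {g : ℝ → G} {b : G}
    (hg : Continuous g) (hb : g 0 = b) : Tendsto g (𝓝[>] 0) (𝓝 b) := by
  rw [← hb]
  exact (hg.tendsto 0).mono_left nhdsWithin_le_nhds

theorem norm_toLp_le {G : Type*} [SeminormedAddCommGroup G] (a : G) (b : ℝ) :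
    ‖(WithLp.toLp 2 (a, b) : WithLp 2 (G × ℝ))‖ ≤ ‖a‖ + |b| := by
  rw [WithLp.prod_norm_eq_of_L2]
  change Real.sqrt (‖a‖ ^ 2 + ‖b‖ ^ 2) ≤ _
  rw [Real.norm_eq_abs]
  refine Real.sqrt_le_iff.2 ⟨by positivity, ?_⟩
  nlinarith [mul_nonneg (norm_nonneg a) (abs_nonneg b)]

set_option maxHeartbeats 800000 in
/-- A penalized first-order estimate for regular normals to the epigraph of `θ ∘ f`. -/
theorem inner_le_of_regularNormal {φ : E → EReal} {θ : F → EReal} {f : E → F} {x : E}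
    (hb : ∀ y, θ y ≠ ⊥) (hc : ConvexOn ℝ (dom θ) fun y => (θ y).toReal) {C ρ : ℝ} (hC : 0 ≤ C)
    (hρ : 0 < ρ)
    (hlip : ∀ y ∈ dom θ, ∀ y' ∈ dom θ, y ∈ Metric.ball (f x) ρ → y' ∈ Metric.ball (f x) ρ →
        |(θ y).toReal - (θ y').toReal| ≤ C * ‖y - y'‖)
    (hcorr : ∀ u ∈ Metric.ball x ρ, ∀ y ∈ dom θ, y ∈ Metric.ball (f x) ρ →
      ∀ η : ℝ, 0 < η → η < ρ →
        ∃ u', f u' ∈ dom θ ∧ φ u' = θ (f u') ∧ ‖u' - u‖ ≤ C * (‖f u - y‖ + η) ∧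
          |(θ (f u')).toReal - (θ y).toReal| ≤ C * (‖f u - y‖ + η))
    {a : E} {r : ℝ} (ha : a ∈ Metric.ball x ρ) (hfa : f a ∈ Metric.ball (f x) ρ)
    (hφa : φ a = θ (f a)) (har : φ a ≤ (r : EReal)) (hd : DifferentiableAt ℝ f a)
    {u : E} {μ : ℝ} (hμ : 0 ≤ μ)
    (hn : WithLp.toLp 2 (u, -μ) ∈ regularNormalCone (epi φ) (WithLp.toLp 2 (a, r)))
    {y' : F} (hy' : y' ∈ dom θ) {M : ℝ} (hM : 0 ≤ M) (w : E) :
    inner ℝ u w ≤ μ * (M * ((θ y').toReal - (θ (f a)).toReal)) +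
      C * (‖u‖ + μ) * ‖fderiv ℝ f a w - M • (y' - f a)‖ := by
  have had : f a ∈ dom θ := by
    change θ (f a) < ⊤
    rw [← hφa]
    exact har.trans_lt (EReal.coe_lt_top r)
  have har' : (θ (f a)).toReal ≤ r := by
    rw [hφa, ← coe_toReal_of_mem_dom hb had] at har
    exact EReal.coe_le_coe_iff.1 har
  set ξ := M • (y' - f a) with hξ
  set N := ‖fderiv ℝ f a w - ξ‖ with hN
  set Δ := (θ y').toReal - (θ (f a)).toReal with hΔ
  -- For small `t` the point `a + t • w` is corrected towards the target `f a + t • ξ`, which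
  -- convexity places in the domain. The corrected point, with its change of value, is then tested
  -- against the normal.
  have key : ∀ ε : ℝ, 0 < ε →
      inner ℝ u w ≤ μ * (M * Δ) + C * (‖u‖ + μ) * (N + 2 * ε) + ε := by
    intro ε hε
    set D := ‖w‖ + 2 * (C * (N + 2 * ε)) + C * ‖ξ‖ + 1 with hD
    have hN0 : 0 ≤ N := norm_nonneg _
    have hD0 : 0 < D := by positivity
    have hreg := hn (ε / D) (by positivity)
    rw [eventually_nhdsWithin_iff, Metric.eventually_nhds_iff_ball] at hreg
    obtain ⟨δ, hδ, hreg⟩ := hreg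
    have c1 : ∀ᶠ t in 𝓝[>] (0 : ℝ), ‖f (a + t • w) - f a - t • fderiv ℝ f a w‖ ≤ t * ε := by
      have h1 := hd.hasFDerivAt.isLittleO
      rw [Asymptotics.isLittleO_iff] at h1
      have h2 : Tendsto (fun t : ℝ => a + t • w) (𝓝[>] 0) (𝓝 a) := by
        have : Tendsto (fun t : ℝ => a + t • w) (𝓝 0) (𝓝 (a + (0 : ℝ) • w)) :=
          (by fun_prop : Continuous fun t : ℝ => a + t • w).tendsto _
        rw [zero_smul, add_zero] at this
        exact this.mono_left nhdsWithin_le_nhds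
      have h3 := h2.eventually (h1 (by positivity : 0 < ε / (‖w‖ + 1)))
      filter_upwards [h3, self_mem_nhdsWithin] with t ht ht0
      have ht0' : (0 : ℝ) < t := ht0
      rw [add_sub_cancel_left, map_smul, norm_smul, Real.norm_of_nonneg ht0'.le] at ht
      refine ht.trans ?_
      have : ε / (‖w‖ + 1) * (t * ‖w‖) = t * ε * (‖w‖ / (‖w‖ + 1)) := by ring
      rw [this]
      refine mul_le_of_le_one_right (by positivity) ?_
      rw [div_le_one (by positivity)]
      linarith
    have c2 : ∀ᶠ t in 𝓝[>] (0 : ℝ), a + t • w ∈ Metric.ball x ρ := by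
      have h1 : ∀ᶠ t in 𝓝 (0 : ℝ), a + t • w ∈ Metric.ball x ρ :=
        (by fun_prop : Continuous fun t : ℝ => a + t • w).continuousAt.eventually
          (Metric.isOpen_ball.mem_nhds (by simpa using ha))
      exact h1.filter_mono nhdsWithin_le_nhds
    have c3 : ∀ᶠ t in 𝓝[>] (0 : ℝ), f a + t • ξ ∈ Metric.ball (f x) ρ := by
      have h1 : ∀ᶠ t in 𝓝 (0 : ℝ), f a + t • ξ ∈ Metric.ball (f x) ρ :=
        (by fun_prop : Continuous fun t : ℝ => f a + t • ξ).continuousAt.eventually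
          (Metric.isOpen_ball.mem_nhds (by simpa using hfa))
      exact h1.filter_mono nhdsWithin_le_nhds
    have c4 : ∀ b : ℝ, 0 < b → ∀ᶠ t in 𝓝[>] (0 : ℝ), t < b := fun b hb' =>
      Filter.mem_of_superset (Ioo_mem_nhdsGT hb') fun t ht => ht.2
    obtain ⟨t, ht1, ht2, ht3, ht4, ht5, ht6, ht7, ht8, ht0⟩ :=
      (c1.and (c2.and (c3.and ((c4 ε hε).and ((c4 ρ hρ).and ((c4 1 one_pos).and
        ((c4 (1 / (M + 1)) (by positivity)).and
          ((c4 (δ / D) (by positivity)).and self_mem_nhdsWithin)))))))).exists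
    have ht0' : (0 : ℝ) < t := ht0
    have htM : t * M ≤ 1 := by
      rw [lt_div_iff₀ (by positivity)] at ht7
      linarith
    obtain ⟨hyd, hyle⟩ := ConvexOn.add_smul_mem_and_le hc had hy' (mul_nonneg ht0'.le hM) htM
    rw [mul_smul, ← hξ] at hyd hyle
    have htt : t * t < ρ := (mul_lt_of_lt_one_left ht0' ht6).trans ht5
    -- The slack `t * t` is of higher order than `t` and is absorbed by `ε`.
    obtain ⟨x', hx'd, hx'φ, hx'1, hx'2⟩ := hcorr _ ht2 _ hyd ht3 (t * t) (by positivity) htt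
    have hdist : ‖f (a + t • w) - (f a + t • ξ)‖ + t * t ≤ t * (N + 2 * ε) := by
      have e : f (a + t • w) - (f a + t • ξ) =
          (f (a + t • w) - f a - t • fderiv ℝ f a w) + t • (fderiv ℝ f a w - ξ) := by
        rw [smul_sub]; abel
      have h1 := norm_add_le (f (a + t • w) - f a - t • fderiv ℝ f a w)
        (t • (fderiv ℝ f a w - ξ))
      rw [← e, norm_smul, Real.norm_of_nonneg ht0'.le, ← hN] at h1
      have h2 := mul_le_mul_of_nonneg_left ht4.le ht0'.le
      linarith
    have hx'1' := hx'1.trans (mul_le_mul_of_nonneg_left hdist hC)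
    have hx'2' := hx'2.trans (mul_le_mul_of_nonneg_left hdist hC)
    have hl := hlip _ hyd _ had ht3 hfa
    rw [add_sub_cancel_left, norm_smul, Real.norm_of_nonneg ht0'.le] at hl
    set Θ := (θ (f x')).toReal - (θ (f a)).toReal with hΘ
    have hΘabs : |Θ| ≤ C * (t * (N + 2 * ε)) + C * (t * ‖ξ‖) := by
      have e : Θ = ((θ (f x')).toReal - (θ (f a + t • ξ)).toReal) +
        ((θ (f a + t • ξ)).toReal - (θ (f a)).toReal) := by rw [hΘ]; ring
      rw [e]
      exact (abs_add_le _ _).trans (add_le_add hx'2' hl)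
    have hΘle : Θ ≤ t * (M * Δ) + C * (t * (N + 2 * ε)) := by
      have := (abs_le.1 hx'2').2
      rw [hΘ]
      rw [← hΔ, mul_assoc] at hyle
      linarith
    have hxa : ‖x' - a‖ ≤ C * (t * (N + 2 * ε)) + t * ‖w‖ := by
      have e : x' - a = (x' - (a + t • w)) + t • w := by abel
      rw [e]
      refine (norm_add_le _ _).trans (add_le_add hx'1' ?_)
      rw [norm_smul, Real.norm_of_nonneg ht0'.le]
    -- The increment `Θ` is added to `r`, so the test also works at points strictly above the graph.
    have hmem : WithLp.toLp 2 (x', r + Θ) ∈ epi φ := by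
      change φ x' ≤ ((r + Θ : ℝ) : EReal)
      rw [hx'φ, ← coe_toReal_of_mem_dom hb hx'd, EReal.coe_le_coe_iff, hΘ]
      linarith
    have e1 : (WithLp.toLp 2 (x', r + Θ) - WithLp.toLp 2 (a, r) : WithLp 2 (E × ℝ)) =
        WithLp.toLp 2 (x' - a, Θ) := by
      rw [← WithLp.toLp_sub, Prod.mk_sub_mk, add_sub_cancel_left]
    have hnorm : ‖(WithLp.toLp 2 (x' - a, Θ) : WithLp 2 (E × ℝ))‖ ≤ t * (D - 1) := by
      have h1 : ‖(WithLp.toLp 2 (x' - a, Θ) : WithLp 2 (E × ℝ))‖ ≤ ‖x' - a‖ + |Θ| :=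
        norm_toLp_le _ _
      refine h1.trans ?_
      rw [hD]
      linarith
    have hlt : ‖(WithLp.toLp 2 (x' - a, Θ) : WithLp 2 (E × ℝ))‖ < δ := by
      rw [lt_div_iff₀ hD0] at ht8
      linarith
    have hfin := hreg (WithLp.toLp 2 (x', r + Θ)) (by rw [mem_ball_iff_norm, e1]; exact hlt) hmem
    rw [e1, WithLp.prod_inner_apply] at hfin
    change inner ℝ u (x' - a) + inner ℝ (-μ) Θ ≤ _ at hfin
    have e2 : inner ℝ (-μ) Θ = -(μ * Θ) := by simp [mul_comm]
    have h11 : ε / D * ‖(WithLp.toLp 2 (x' - a, Θ) : WithLp 2 (E × ℝ))‖ ≤ t * ε := by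
      calc _ ≤ ε / D * (t * D) := by gcongr; linarith
        _ = t * ε := by field_simp
    rw [e2] at hfin
    have h12 : t * inner ℝ u w ≤ inner ℝ u (x' - a) + ‖u‖ * (C * (t * (N + 2 * ε))) := by
      have e : x' - a = (x' - (a + t • w)) + t • w := by abel
      rw [e, inner_add_right, inner_smul_right]
      have h13 := (abs_le.1 (abs_real_inner_le_norm u (x' - (a + t • w)))).1
      have h14 := mul_le_mul_of_nonneg_left hx'1' (norm_nonneg u)
      linarith
    have h15 := mul_le_mul_of_nonneg_left hΘle hμ
    refine le_of_mul_le_mul_left ?_ ht0'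
    linarith
  have hK : 0 ≤ C * (‖u‖ + μ) := by positivity
  have hlim : Tendsto (fun ε : ℝ => μ * (M * Δ) + C * (‖u‖ + μ) * (N + 2 * ε) + ε) (𝓝[>] 0)
      (𝓝 (μ * (M * Δ) + C * (‖u‖ + μ) * N)) := by
    have h1 := (by fun_prop : Continuous fun ε : ℝ =>
      μ * (M * Δ) + C * (‖u‖ + μ) * (N + 2 * ε) + ε).tendsto 0
    simp only [mul_zero, add_zero] at h1
    exact h1.mono_left nhdsWithin_le_nhds
  exact ge_of_tendsto hlim (by filter_upwards [self_mem_nhdsWithin] with ε hε using key ε hε)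

/-- The chain rule for limiting subgradients. -/
theorem MSQC.exists_subgradient [FiniteDimensional ℝ F] {φ : E → EReal} {θ : F → EReal}
    {f : E → F} {x : E}
    (hm : MSQC θ f x) (hf : TwiceDifferentiableAt f x) (hc : IsConvexFun θ) (hp : IsPLQ θ)
    (hx : f x ∈ dom θ) (hφ : ∀ᶠ y in 𝓝 x, φ y = θ (f y)) {v : E}
    (hv : v ∈ limitingSubdifferential φ x) :
    ∃ l : F, (∀ u, inner ℝ l (fderiv ℝ f x u) = inner ℝ v u) ∧ IsSubgradient θ (f x) l := by
  obtain ⟨C, hC, ρ, hρ, hlip, hcorr⟩ := hm.exists_correction hf hc hp hx hφ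
  have hc' := (isConvexFun_iff hp.ne_bot).1 hc
  have hfc : ContinuousAt f x := hf.1.self_of_nhds.continuousAt
  obtain ⟨-, y, u, hy, hyl, hul, hreg⟩ := hv
  have ha : Tendsto (fun k => (y k).fst) atTop (𝓝 x) :=
    ((by fun_prop : Continuous fun z : WithLp 2 (E × ℝ) => z.fst).tendsto _).comp hyl
  have hu : Tendsto (fun k => (u k).fst) atTop (𝓝 v) :=
    ((by fun_prop : Continuous fun z : WithLp 2 (E × ℝ) => z.fst).tendsto _).comp hul
  have hμ : Tendsto (fun k => -(u k).snd) atTop (𝓝 1) := by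
    have := ((by fun_prop : Continuous fun z : WithLp 2 (E × ℝ) => -z.snd).tendsto _).comp hul
    simpa [Function.comp_def] using this
  have hfa : Tendsto (fun k => f (y k).fst) atTop (𝓝 (f x)) := hfc.tendsto.comp ha
  have hnear : ∀ᶠ k in atTop, (y k).fst ∈ Metric.ball x ρ ∧ f (y k).fst ∈ Metric.ball (f x) ρ ∧
      φ (y k).fst = θ (f (y k).fst) ∧ DifferentiableAt ℝ f (y k).fst ∧ 0 < -(u k).snd := by
    filter_upwards [ha.eventually (Metric.ball_mem_nhds x hρ),
      hfa.eventually (Metric.ball_mem_nhds (f x) hρ), ha.eventually hφ, ha.eventually hf.1,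
      hμ.eventually_const_lt one_pos] with k h1 h2 h3 h4 h5
    exact ⟨h1, h2, h3, h4, h5⟩
  have hθa : Tendsto (fun k => (θ (f (y k).fst)).toReal) atTop (𝓝 (θ (f x)).toReal) := by
    rw [tendsto_iff_norm_sub_tendsto_zero]
    have h1 : Tendsto (fun k => C * ‖f (y k).fst - f x‖) atTop (𝓝 0) := by
      simpa using (tendsto_iff_norm_sub_tendsto_zero.1 hfa).const_mul C
    refine squeeze_zero' (Eventually.of_forall fun k => norm_nonneg _) ?_ h1
    filter_upwards [hnear] with k hk
    refine hlip _ ?_ _ hx hk.2.1 (Metric.mem_ball_self hρ)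
    change θ (f (y k).fst) < ⊤
    rw [← hk.2.2.1]
    exact lt_of_le_of_lt (hy k) (EReal.coe_lt_top _)
  have hTa : Tendsto (fun k => fderiv ℝ f (y k).fst) atTop (𝓝 (fderiv ℝ f x)) :=
    hf.2.continuousAt.tendsto.comp ha
  -- The penalized inequalities at the approximating points pass to the limit, where the weights
  -- tend to 1; the purely first-order case has zero shift and zero `δ`.
  obtain ⟨l, h1, -, h2⟩ := exists_multiplier_of_convex hc' hx (fderiv ℝ f x)
    (L := C * (‖v‖ + 1)) (by positivity) 0 0 v (by
      intro y' hy' M hM w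
      rw [zero_add, add_zero]
      have hL : Tendsto (fun k => inner ℝ (u k).fst w) atTop (𝓝 (inner ℝ v w)) :=
        hu.inner tendsto_const_nhds
      have hR : Tendsto (fun k => -(u k).snd *
          (M * ((θ y').toReal - (θ (f (y k).fst)).toReal)) + C * (‖(u k).fst‖ + -(u k).snd) *
            ‖fderiv ℝ f (y k).fst w - M • (y' - f (y k).fst)‖) atTop
          (𝓝 (1 * (M * ((θ y').toReal - (θ (f x)).toReal)) + C * (‖v‖ + 1) *
            ‖fderiv ℝ f x w - M • (y' - f x)‖)) := by
        have hw : Tendsto (fun k => fderiv ℝ f (y k).fst w) atTop (𝓝 (fderiv ℝ f x w)) :=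
          ((ContinuousLinearMap.apply ℝ F w).continuous.tendsto _).comp hTa
        have k1 := (hθa.const_sub (θ y').toReal).const_mul M
        have k2 := (hw.sub ((hfa.const_sub y').const_smul M)).norm
        have k3 := (hu.norm.add hμ).const_mul C
        have k4 := (hμ.mul k1).add (k3.mul k2)
        exact k4
      rw [one_mul] at hR
      refine le_of_tendsto_of_tendsto hL hR ?_
      filter_upwards [hnear] with k hk
      refine inner_le_of_regularNormal hp.ne_bot hc' hC hρ hlip hcorr hk.1 hk.2.1 hk.2.2.1
        (r := (y k).snd) (hy k) hk.2.2.2.1 hk.2.2.2.2.le ?_ hy' hM w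
      rw [neg_neg]
      exact hreg k)
  exact ⟨l, h1, h2⟩

set_option maxHeartbeats 800000 in
/-- The upper estimate in the second-order chain rule: along a direction in which `θ` is
linear-quadratic with matching slope, some multiplier realizes the second subderivative. -/
theorem MSQC.exists_subgradient_secondSubderivative_le [FiniteDimensional ℝ F] {φ : E → EReal}
    {θ : F → EReal} {f : E → F} {x : E}
    (hm : MSQC θ f x) (hf : TwiceDifferentiableAt f x) (hc : IsConvexFun θ) (hp : IsPLQ θ)
    (hx : f x ∈ dom θ) (hφ : ∀ᶠ y in 𝓝 x, φ y = θ (f y)) {v w : E}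
    (hbot : secondSubderivative φ x v w ≠ ⊥) {q s₀ : ℝ} (hs₀ : 0 < s₀)
    (hray : ∀ s : ℝ, 0 ≤ s → s ≤ s₀ → f x + s • fderiv ℝ f x w ∈ dom θ ∧
        (θ (f x + s • fderiv ℝ f x w)).toReal =
          (θ (f x)).toReal + s * inner ℝ v w + s ^ 2 / 2 * q) :
    ∃ l : F, (∀ u, inner ℝ l (fderiv ℝ f x u) = inner ℝ v u) ∧ IsSubgradient θ (f x) l ∧
      secondSubderivative φ x v w ≤
        ((q + inner ℝ l (fderiv ℝ (fderiv ℝ f) x w w) : ℝ) : EReal) := by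
  obtain ⟨C, hC, ρ, hρ, hlip, hcorr⟩ := hm.exists_correction hf hc hp hx hφ
  have hc' := (isConvexFun_iff hp.ne_bot).1 hc
  have hφx : φ x = θ (f x) := hφ.self_of_nhds
  have hφx' : ((φ x).toReal : EReal) = φ x := by
    rw [hφx, coe_toReal_of_mem_dom hp.ne_bot hx]
  set T := fderiv ℝ f x with hT
  set c := fderiv ℝ (fderiv ℝ f) x w w with hcdef
  -- The test curves are the parabolas x + t w + (t²/2) p, whose images are f x + t T w + (t²/2)(T p
  -- + c) up to o(t²). They are corrected towards points of the domain with second-order part `ξ`.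
  have key : ∀ D : ℝ, (D : EReal) < secondSubderivative φ x v w → ∀ y' ∈ dom θ, ∀ M : ℝ, 0 ≤ M →
      ∀ p : E, D + inner ℝ v p ≤ q + M * ((θ y').toReal - (θ (f x)).toReal) +
        C * (1 + ‖v‖) * ‖T p + c - M • (y' - f x)‖ := by
    intro D hD y' hy' M hM p
    have hev := eventually_of_lt_secondSubderivative hφx' hD
    rw [hφx] at hev
    set ξ := M • (y' - f x) with hξ
    set Δ := (θ y').toReal - (θ (f x)).toReal with hΔ
    let R : ℝ → F := fun t => (t ^ 2 / 2)⁻¹ •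
      (f (x + t • (w + (t / 2) • p)) - f x - t • T (w + (t / 2) • p))
    have hR : Tendsto R (𝓝[>] 0) (𝓝 c) := by
      have h1 : Tendsto (fun t : ℝ => w + (t / 2) • p) (𝓝[>] 0) (𝓝 w) :=
        tendsto_nhdsGT_zero (by fun_prop) (by simp)
      have h2 : Tendsto (fun t : ℝ => (t, w + (t / 2) • p)) (𝓝[>] 0) (𝓝[>] 0 ×ˢ 𝓝 w) :=
        tendsto_id.prodMk h1
      have h3 := (hf.tendsto w).comp h2
      exact h3
    let Err : ℝ → ℝ := fun t => C * (‖T p + R t - ξ‖ + t)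
    have hErr : Tendsto Err (𝓝[>] 0) (𝓝 (C * ‖T p + c - ξ‖)) := by
      have h1 : Tendsto (fun t : ℝ => t) (𝓝[>] 0) (𝓝 0) := tendsto_nhdsGT_zero continuous_id rfl
      simpa using (((tendsto_const_nhds.add hR).sub tendsto_const_nhds).norm.add h1).const_mul C
    have hex : ∀ᶠ t in 𝓝[>] (0 : ℝ), ∃ x' : E, φ x' = θ (f x') ∧ f x' ∈ dom θ ∧
        ‖x' - (x + t • (w + (t / 2) • p))‖ ≤ t ^ 2 / 2 * Err t ∧
        (θ (f x')).toReal ≤ (θ (f x)).toReal + t * inner ℝ v w +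
          t ^ 2 / 2 * (q / (1 - t ^ 2 / 2 * M) + M * Δ + Err t) := by
      have c1 : ∀ᶠ t in 𝓝[>] (0 : ℝ), x + t • (w + (t / 2) • p) ∈ Metric.ball x ρ :=
        (tendsto_nhdsGT_zero (b := x) (by fun_prop) (by simp)).eventually_mem
          (Metric.ball_mem_nhds x hρ)
      have c2 : ∀ᶠ t in 𝓝[>] (0 : ℝ),
          f x + t • T w + (t ^ 2 / 2) • ξ ∈ Metric.ball (f x) ρ :=
        (tendsto_nhdsGT_zero (b := f x) (by fun_prop) (by simp)).eventually_mem
          (Metric.ball_mem_nhds (f x) hρ)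
      have c3 : ∀ᶠ t in 𝓝[>] (0 : ℝ), t ^ 2 / 2 * t < ρ :=
        (tendsto_nhdsGT_zero (b := 0) (by fun_prop) (by simp)).eventually_lt_const hρ
      have c4 : ∀ᶠ t in 𝓝[>] (0 : ℝ), t ^ 2 / 2 * M < 1 / 2 :=
        (tendsto_nhdsGT_zero (b := 0) (by fun_prop) (by simp)).eventually_lt_const (by norm_num)
      have c5 : ∀ᶠ t in 𝓝[>] (0 : ℝ), 2 * t < s₀ :=
        (tendsto_nhdsGT_zero (b := 0) (by fun_prop) (by simp)).eventually_lt_const hs₀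
      filter_upwards [c1, c2, c3, c4, c5, self_mem_nhdsWithin] with t h1 h2 h3 h4 h5 h6
      have ht : (0 : ℝ) < t := h6
      set σ := t ^ 2 / 2 * M with hσ
      have hσ0 : 0 ≤ σ := by positivity
      have hσ1 : 0 < 1 - σ := by linarith
      -- The ray is followed up to `t'` so that averaging with weight `σ` on `y'` lands exactly on f
      -- x + t T w + (t²/2) ξ.
      set t' := t / (1 - σ) with ht'
      have ht'0 : 0 ≤ t' := by positivity
      have ht't : (1 - σ) * t' = t := by rw [ht']; field_simp
      have ht's : t' ≤ s₀ := by
        rw [ht', div_le_iff₀ hσ1]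
        nlinarith [mul_lt_mul_of_pos_left h4 hs₀]
      obtain ⟨hr1, hr2⟩ := hray t' ht'0 ht's
      have e1 : (1 - σ) • (f x + t' • T w) + σ • y' = f x + t • T w + (t ^ 2 / 2) • ξ := by
        rw [hξ, smul_smul, ← hσ, smul_add, smul_smul, ht't, smul_sub, sub_smul, one_smul]
        abel
      have hy1 := hc'.1 hr1 hy' hσ1.le hσ0 (sub_add_cancel 1 σ)
      have hy2 := hc'.2 hr1 hy' hσ1.le hσ0 (sub_add_cancel 1 σ)
      rw [e1] at hy1 hy2
      simp only [smul_eq_mul] at hy2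
      obtain ⟨x', hx'd, hx'φ, hx'1, hx'2⟩ := hcorr _ h1 _ hy1 h2 (t ^ 2 / 2 * t) (by positivity) h3
      have e2 : f (x + t • (w + (t / 2) • p)) - (f x + t • T w + (t ^ 2 / 2) • ξ) =
          (t ^ 2 / 2) • (T p + R t - ξ) := by
        have e3 : (t ^ 2 / 2) • R t =
            f (x + t • (w + (t / 2) • p)) - f x - t • T (w + (t / 2) • p) := by
          simp only [R]
          rw [smul_smul, mul_inv_cancel₀ (by positivity), one_smul]
        rw [smul_sub, smul_add (t ^ 2 / 2), e3, map_add, map_smul, smul_add t (T w),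
          smul_smul t (t / 2)]
        have : t * (t / 2) = t ^ 2 / 2 := by ring
        rw [this]
        abel
      rw [e2, norm_smul, Real.norm_of_nonneg (by positivity : (0 : ℝ) ≤ t ^ 2 / 2), ← mul_add,
        mul_left_comm] at hx'1 hx'2
      refine ⟨x', hx'φ, hx'd, hx'1, ?_⟩
      have h7 := (abs_le.1 hx'2).2
      have h8 : (1 - σ) * (t' ^ 2 / 2 * q) = t ^ 2 / 2 * (q / (1 - σ)) := by
        rw [ht']; field_simp
      have h9 : (1 - σ) * (t' * inner ℝ v w) = t * inner ℝ v w := by rw [← mul_assoc, ht't]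
      have h10 : (1 - σ) * (θ (f x + t' • T w)).toReal + σ * (θ y').toReal =
          (θ (f x)).toReal + t * inner ℝ v w + t ^ 2 / 2 * (q / (1 - σ)) + σ * Δ := by
        rw [hr2, mul_add, mul_add, h8, h9, hΔ]; ring
      have h11 : t ^ 2 / 2 * (q / (1 - σ) + M * Δ + Err t) =
          t ^ 2 / 2 * (q / (1 - σ)) + σ * Δ + t ^ 2 / 2 * Err t := by rw [hσ]; ring
      rw [h11]
      simp only [Err]
      linarith
    obtain ⟨X, hX⟩ := hex.choice
    -- The correction is of order t², so the corrected points are still tangent to `w` and compete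
    -- in the lower limit.
    have hU : Tendsto (fun t => t⁻¹ • (X t - x)) (𝓝[>] 0) (𝓝 w) := by
      rw [tendsto_iff_norm_sub_tendsto_zero]
      have h1 : Tendsto (fun t : ℝ => t / 2 * (Err t + ‖p‖)) (𝓝[>] 0) (𝓝 0) := by
        have h2 : Tendsto (fun t : ℝ => t / 2) (𝓝[>] 0) (𝓝 0) :=
          tendsto_nhdsGT_zero (by fun_prop) (by simp)
        simpa using h2.mul (hErr.add_const ‖p‖)
      refine squeeze_zero' (Eventually.of_forall fun t => norm_nonneg _) ?_ h1
      filter_upwards [hX, self_mem_nhdsWithin] with t ht1 ht2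
      have ht : (0 : ℝ) < t := ht2
      have e1 : t⁻¹ • (X t - x) - w =
          t⁻¹ • (X t - (x + t • (w + (t / 2) • p))) + (t / 2) • p := by
        rw [← sub_sub, smul_sub _ (X t - x), smul_smul, inv_mul_cancel₀ ht.ne', one_smul]
        abel
      rw [e1]
      refine (norm_add_le _ _).trans ?_
      rw [norm_smul, norm_smul, norm_inv, Real.norm_of_nonneg ht.le,
        Real.norm_of_nonneg (half_pos ht).le, mul_add]
      refine add_le_add_left ?_ _
      rw [inv_mul_le_iff₀ ht]
      refine ht1.2.2.1.trans (le_of_eq ?_)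
      ring
    have hD1 := (tendsto_id.prodMk hU).eventually hev
    have hfin : ∀ᶠ t in 𝓝[>] (0 : ℝ), D + inner ℝ v p ≤
        q / (1 - t ^ 2 / 2 * M) + M * Δ + (1 + ‖v‖) * Err t := by
      filter_upwards [hX, hD1, self_mem_nhdsWithin] with t ht1 ht2 ht3
      have ht : (0 : ℝ) < t := ht3
      obtain ⟨g1, g2, g3, g4⟩ := ht1
      simp only [id] at ht2
      rw [smul_smul, mul_inv_cancel₀ ht.ne', one_smul, add_sub_cancel, g1,
        ← coe_toReal_of_mem_dom hp.ne_bot g2, EReal.coe_le_coe_iff, inner_smul_right,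
        ← mul_assoc, mul_inv_cancel₀ ht.ne', one_mul] at ht2
      have h1 := (abs_le.1 (abs_real_inner_le_norm v (X t - (x + t • (w + (t / 2) • p))))).1
      have h2 := mul_le_mul_of_nonneg_left g3 (norm_nonneg v)
      have h3 : inner ℝ v (X t - (x + t • (w + (t / 2) • p))) =
          inner ℝ v (X t - x) - t * inner ℝ v w - t ^ 2 / 2 * inner ℝ v p := by
        rw [← sub_sub, inner_sub_right, inner_smul_right, inner_add_right, inner_smul_right]
        ring
      rw [h3] at h1
      have ht2' : 0 < t ^ 2 / 2 := by positivity
      refine le_of_mul_le_mul_left ?_ ht2'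
      linarith
    have hlim : Tendsto (fun t : ℝ => q / (1 - t ^ 2 / 2 * M) + M * Δ + (1 + ‖v‖) * Err t)
        (𝓝[>] 0) (𝓝 (q / 1 + M * Δ + (1 + ‖v‖) * (C * ‖T p + c - ξ‖))) := by
      have h1 : Tendsto (fun t : ℝ => 1 - t ^ 2 / 2 * M) (𝓝[>] 0) (𝓝 1) :=
        tendsto_nhdsGT_zero (by fun_prop) (by simp)
      exact ((tendsto_const_nhds.div h1 one_ne_zero).add_const _).add (hErr.const_mul _)
    have := ge_of_tendsto hlim hfin
    rw [div_one] at this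
    linarith
  set S := secondSubderivative φ x v w with hS
  have htop : S ≠ ⊤ := by
    intro htop
    -- Taking `y' = f x`, `M = 0` and `p = 0` in `key` bounds every real number below the second
    -- subderivative.
    have := key (q + C * (1 + ‖v‖) * ‖c‖ + 1) (by rw [htop]; exact EReal.coe_lt_top _) (f x) hx 0
      le_rfl 0
    simp at this
    linarith
  have hS' : ((S.toReal : ℝ) : EReal) = S := EReal.coe_toReal htop hbot
  -- With shift `c` and this `δ`, the bound `δ ≤ ⟨l, c⟩` is the desired upper estimate.
  obtain ⟨l, h1, h2, h3⟩ := exists_multiplier_of_convex hc' hx T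
    (L := C * (1 + ‖v‖)) (by positivity) c (S.toReal - q) v (by
      intro y' hy' M hM p
      have : S.toReal ≤ q + M * ((θ y').toReal - (θ (f x)).toReal) +
        C * (1 + ‖v‖) * ‖T p + c - M • (y' - f x)‖ - inner ℝ v p := by
        refine le_of_forall_lt_imp_le_of_dense fun D hD => ?_
        have := key D (by rw [← hS']; exact_mod_cast hD) y' hy' M hM p
        linarith
      linarith)
  refine ⟨l, h1, h3, ?_⟩
  rw [← hS', EReal.coe_le_coe_iff]
  linarith

/-! ### Second subderivatives of sums -/

theorem secondQuotient_of_coe {φ : E → EReal} {x v w : E} {t r a : ℝ} (hr : φ x = r)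
    (ha : φ (x + t • w) = a) :
    secondQuotient φ x v t w = (((a - r - t * inner ℝ v w) / (t ^ 2 / 2) : ℝ) : EReal) := by
  rw [secondQuotient, hr, ha, ← EReal.coe_sub, ← EReal.coe_sub, ← EReal.coe_div]

theorem secondQuotient_of_top {φ : E → EReal} {x v w : E} {t r : ℝ} (ht : 0 < t) (hr : φ x = r)
    (ha : φ (x + t • w) = ⊤) : secondQuotient φ x v t w = ⊤ := by
  have ht2 : (0 : ℝ) < t ^ 2 / 2 := by positivity
  rw [secondQuotient, hr, ha, EReal.top_sub_coe, EReal.top_sub_coe,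
    EReal.top_div_of_pos_ne_top (by exact_mod_cast ht2) (EReal.coe_ne_top _)]

/-- No finiteness is needed: the convention `⊥ + ⊤ = ⊥` only lowers the left-hand side. -/
theorem sum_liminf_le {α ι : Type*} (l : Filter α) [l.NeBot] (s : Finset ι) (u : ι → α → EReal) :
    ∑ i ∈ s, liminf (u i) l ≤ liminf (fun a => ∑ i ∈ s, u i a) l := by
  classical
  induction s using Finset.induction_on with
  | empty => simp
  | insert i s hi ih =>
    simp only [Finset.sum_insert hi]
    exact (add_le_add le_rfl ih).trans EReal.le_liminf_add

/-- The quotients add up exactly where all terms are finite; elsewhere the quotient of the sum is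
`⊤`. -/
theorem sum_secondSubderivative_le {ι : Type*} [Fintype ι] {φ : ι → E → EReal}
    (hb : ∀ i y, φ i y ≠ ⊥) {x : E} (hx : ∀ i, x ∈ dom (φ i)) (v : ι → E) (w : E) :
    ∑ i, secondSubderivative (φ i) x (v i) w ≤
      secondSubderivative (fun y => ∑ i, φ i y) x (∑ i, v i) w := by
  refine (sum_liminf_le _ Finset.univ
    (fun i (p : ℝ × E) => secondQuotient (φ i) x (v i) p.1 p.2)).trans ?_
  refine liminf_le_liminf ?_
  filter_upwards [eventually_pos_prod (𝓝 w)] with p hp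
  have hsum : ∑ i, φ i x = ((∑ i, (φ i x).toReal : ℝ) : EReal) := by
    rw [coe_sum]
    exact Finset.sum_congr rfl fun i _ => (coe_toReal_of_mem_dom (hb i) (hx i)).symm
  by_cases hd : ∀ i, x + p.1 • p.2 ∈ dom (φ i)
  · have hsum' : ∑ i, φ i (x + p.1 • p.2) =
        ((∑ i, (φ i (x + p.1 • p.2)).toReal : ℝ) : EReal) := by
      rw [coe_sum]
      exact Finset.sum_congr rfl fun i _ => (coe_toReal_of_mem_dom (hb i) (hd i)).symm
    rw [secondQuotient_of_coe (φ := fun y => ∑ i, φ i y) hsum hsum',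
      Finset.sum_congr rfl fun i _ => secondQuotient_of_coe
        (coe_toReal_of_mem_dom (hb i) (hx i)).symm (coe_toReal_of_mem_dom (hb i) (hd i)).symm,
      ← coe_sum, EReal.coe_le_coe_iff, ← Finset.sum_div, Finset.sum_sub_distrib,
      Finset.sum_sub_distrib, sum_inner, Finset.mul_sum]
  · have htop : ∑ i, φ i (x + p.1 • p.2) = ⊤ :=
      eq_top_of_notMem_dom (θ := fun y => ∑ i, φ i y) fun h => hd ((mem_dom_sum hb).1 h)
    rw [secondQuotient_of_top (φ := fun y => ∑ i, φ i y) hp hsum htop]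
    exact le_top

/-! ### Distances -/

/-- Points outside the ball of radius `r` are no closer to `y` than `x` is when `y` is within `r /
2` of `x`. This is needed because the composite representations hold only locally. -/
theorem eventually_infDist_eq {X : Type*} [PseudoMetricSpace X] {S S' : Set X} {x : X}
    (hx : x ∈ S) (hx' : x ∈ S')
    (h : ∀ᶠ y in 𝓝 x, y ∈ S ↔ y ∈ S') :
    ∀ᶠ y in 𝓝 x, Metric.infDist y S = Metric.infDist y S' := by
  obtain ⟨r, hr, hball⟩ := Metric.eventually_nhds_iff_ball.1 h
  have main : ∀ A B : Set X, x ∈ A → (∀ y ∈ Metric.ball x r, y ∈ B → y ∈ A) → x ∈ B →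
      ∀ y ∈ Metric.ball x (r / 2), Metric.infDist y A ≤ Metric.infDist y B := by
    intro A B hA hAB hB y hy
    rw [Metric.le_infDist ⟨x, hB⟩]
    intro b hb
    by_cases hbx : b ∈ Metric.ball x r
    · exact Metric.infDist_le_dist_of_mem (hAB b hbx hb)
    · refine (Metric.infDist_le_dist_of_mem hA).trans ?_
      rw [Metric.mem_ball, not_lt] at hbx
      rw [Metric.mem_ball] at hy
      have := dist_triangle_right b x y
      rw [dist_comm b y, dist_comm x y] at this
      linarith
  filter_upwards [Metric.ball_mem_nhds x (half_pos hr)] with y hy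
  exact le_antisymm (main S S' hx (fun z hz hz' => (hball z hz).2 hz') hx' y hy)
    (main S' S hx' (fun z hz hz' => (hball z hz).1 hz') hx y hy)

theorem infDist_map_le {G : Type*} [NormedAddCommGroup G] [NormedSpace ℝ G] (L : F →L[ℝ] G)
    {S : Set F} {S' : Set G} (hS : S.Nonempty) (h : ∀ y ∈ S, L y ∈ S') (y : F) :
    Metric.infDist (L y) S' ≤ (‖L‖ + 1) * Metric.infDist y S := by
  have hL : 0 < ‖L‖ + 1 := by positivity
  rw [← div_le_iff₀' hL, Metric.le_infDist hS]
  intro a ha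
  rw [div_le_iff₀' hL]
  refine (Metric.infDist_le_dist_of_mem (h a ha)).trans ?_
  rw [dist_eq_norm, dist_eq_norm, ← map_sub]
  refine (L.le_opNorm _).trans ?_
  gcongr
  linarith

/-! ### Mappings into products -/

/-- Finite products of Euclidean spaces embed into a Euclidean space, with complemented
factors. -/
theorem exists_euclidean_product {s : ℕ} (m : Fin s → ℕ) :
    ∃ (N : ℕ) (P : ∀ i, EuclideanSpace ℝ (Fin N) →L[ℝ] EuclideanSpace ℝ (Fin (m i)))
      (J : ∀ i, EuclideanSpace ℝ (Fin (m i)) →L[ℝ] EuclideanSpace ℝ (Fin N)),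
      (∀ i y, P i (J i y) = y) ∧ ∀ i j, i ≠ j → ∀ y, P i (J j y) = 0 := by
  let G := PiLp 2 fun i => EuclideanSpace ℝ (Fin (m i))
  let e : G ≃L[ℝ] EuclideanSpace ℝ (Fin (Module.finrank ℝ G)) :=
    (stdOrthonormalBasis ℝ G).repr.toContinuousLinearEquiv
  let c : G ≃L[ℝ] ∀ i, EuclideanSpace ℝ (Fin (m i)) := PiLp.continuousLinearEquiv 2 ℝ _
  refine ⟨Module.finrank ℝ G,
    fun i => (ContinuousLinearMap.proj i).comp (c.toContinuousLinearMap.comp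
      e.symm.toContinuousLinearMap),
    fun i => e.toContinuousLinearMap.comp (c.symm.toContinuousLinearMap.comp
      (ContinuousLinearMap.single ℝ (fun i => EuclideanSpace ℝ (Fin (m i))) i)), ?_, ?_⟩
  · intro i y
    simp
  · intro i j hij y
    simp [hij]

theorem hasFDerivAt_sum_comp {ι : Type*} [Fintype ι] {G : ι → Type*}
    [∀ i, NormedAddCommGroup (G i)] [∀ i, NormedSpace ℝ (G i)] (J : ∀ i, G i →L[ℝ] F)
    {f : ∀ i, E → G i} {x : E} (hf : ∀ i, DifferentiableAt ℝ (f i) x) :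
    HasFDerivAt (fun y => ∑ i, J i (f i y)) (∑ i, (J i).comp (fderiv ℝ (f i) x)) x :=
  HasFDerivAt.fun_sum fun i _ => (J i).hasFDerivAt.comp x (hf i).hasFDerivAt

theorem eventually_fderiv_sum_comp {ι : Type*} [Fintype ι] {G : ι → Type*}
    [∀ i, NormedAddCommGroup (G i)] [∀ i, NormedSpace ℝ (G i)] (J : ∀ i, G i →L[ℝ] F)
    {f : ∀ i, E → G i} {x : E} (hf : ∀ i, TwiceDifferentiableAt (f i) x) :
    fderiv ℝ (fun y => ∑ i, J i (f i y)) =ᶠ[𝓝 x] fun y => ∑ i, (J i).comp (fderiv ℝ (f i) y) := by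
  filter_upwards [eventually_all.2 fun i => (hf i).1] with y hy
  exact (hasFDerivAt_sum_comp J hy).fderiv

theorem hasFDerivAt_fderiv_sum_comp {ι : Type*} [Fintype ι] {G : ι → Type*}
    [∀ i, NormedAddCommGroup (G i)] [∀ i, NormedSpace ℝ (G i)] (J : ∀ i, G i →L[ℝ] F)
    {f : ∀ i, E → G i} {x : E} (hf : ∀ i, TwiceDifferentiableAt (f i) x) :
    HasFDerivAt (fderiv ℝ (fun y => ∑ i, J i (f i y)))
      (∑ i, (ContinuousLinearMap.compL ℝ E (G i) F (J i)).comp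
        (fderiv ℝ (fderiv ℝ (f i)) x)) x := by
  have h : HasFDerivAt (fun y => ∑ i, ContinuousLinearMap.compL ℝ E (G i) F (J i)
      (fderiv ℝ (f i) y)) (∑ i, (ContinuousLinearMap.compL ℝ E (G i) F (J i)).comp
        (fderiv ℝ (fderiv ℝ (f i)) x)) x :=
    HasFDerivAt.fun_sum fun i _ =>
      (ContinuousLinearMap.compL ℝ E (G i) F (J i)).hasFDerivAt.comp x (hf i).2.hasFDerivAt
  exact h.congr_of_eventuallyEq (eventually_fderiv_sum_comp J hf)

theorem TwiceDifferentiableAt.sum_comp {ι : Type*} [Fintype ι] {G : ι → Type*}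
    [∀ i, NormedAddCommGroup (G i)] [∀ i, NormedSpace ℝ (G i)] (J : ∀ i, G i →L[ℝ] F)
    {f : ∀ i, E → G i} {x : E} (hf : ∀ i, TwiceDifferentiableAt (f i) x) :
    TwiceDifferentiableAt (fun y => ∑ i, J i (f i y)) x :=
  ⟨(eventually_all.2 fun i => (hf i).1).mono fun _ hy =>
    (hasFDerivAt_sum_comp J hy).differentiableAt,
    (hasFDerivAt_fderiv_sum_comp J hf).differentiableAt⟩

/-- Divide the subgradient inequality along the ray by the step and let the step tend to 0. -/
theorem IsSubgradient.inner_le_of_ray {θ : F → EReal} {y l z : F} (hl : IsSubgradient θ y l)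
    {g q s₀ : ℝ} (hs₀ : 0 < s₀)
    (hray : ∀ s : ℝ, 0 ≤ s → s ≤ s₀ → y + s • z ∈ dom θ ∧
        (θ (y + s • z)).toReal = (θ y).toReal + s * g + s ^ 2 / 2 * q) :
    inner ℝ l z ≤ g := by
  have hlim : Tendsto (fun s : ℝ => g + s / 2 * q) (𝓝[>] 0) (𝓝 g) :=
    tendsto_nhdsGT_zero (by fun_prop) (by simp)
  refine ge_of_tendsto hlim ?_
  filter_upwards [Ioo_mem_nhdsGT hs₀] with s hs
  obtain ⟨h1, h2⟩ := hray s hs.1.le hs.2.le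
  have h3 := hl _ h1
  rw [h2, add_sub_cancel_left, inner_smul_right] at h3
  refine le_of_mul_le_mul_left ?_ hs.1
  linarith

end Euclidean

/-! ### Separable sums and their composite representations -/

section SeparableSum

variable {E F ι : Type*} [NormedAddCommGroup E] [InnerProductSpace ℝ E]
  [NormedAddCommGroup F] [InnerProductSpace ℝ F] [Fintype ι] {G : ι → Type*}
  [∀ i, NormedAddCommGroup (G i)] [∀ i, InnerProductSpace ℝ (G i)]

theorem proj_sum_eq {P : ∀ i, F →L[ℝ] G i} {J : ∀ i, G i →L[ℝ] F} (hPJ : ∀ i y, P i (J i y) = y)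
    (hPJ' : ∀ i j, i ≠ j → ∀ y, P i (J j y) = 0) (y : ∀ i, G i) (i : ι) :
    P i (∑ j, J j (y j)) = y i := by
  rw [map_sum, Finset.sum_eq_single i (fun j _ hj => hPJ' i j hj.symm _) (by simp), hPJ]

/-- When only the component `i` of the point varies, all other summands cancel. -/
theorem IsSubgradient.of_separable {P : ∀ i, F →L[ℝ] G i} {J : ∀ i, G i →L[ℝ] F}
    (hPJ : ∀ i y, P i (J i y) = y)
    (hPJ' : ∀ i j, i ≠ j → ∀ y, P i (J j y) = 0) {θ : ∀ i, G i → EReal}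
    (hb : ∀ i y, θ i y ≠ ⊥) {y l : F} (hy : ∀ i, P i y ∈ dom (θ i))
    (hl : IsSubgradient (fun y => ∑ i, θ i (P i y)) y l) (i : ι) {l' : G i}
    (hl' : ∀ u, inner ℝ l' u = inner ℝ l (J i u)) : IsSubgradient (θ i) (P i y) l' := by
  classical
  intro u hu
  have e1 : P i (y + J i (u - P i y)) = u := by rw [map_add, hPJ, add_sub_cancel]
  have e2 : ∀ j, j ≠ i → P j (y + J i (u - P i y)) = P j y := fun j hj => by
    rw [map_add, hPJ' j i hj, add_zero]
  have hb' : ∀ i (y : F), θ i (P i y) ≠ ⊥ := fun i y => hb i _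
  have hmem : ∀ j, P j (y + J i (u - P i y)) ∈ dom (θ j) := by
    intro j
    by_cases hj : j = i
    · subst hj; rwa [e1]
    · rw [e2 j hj]; exact hy j
  have h1 := hl (y + J i (u - P i y)) ((mem_dom_sum (θ := fun i y => θ i (P i y)) hb').2 hmem)
  rw [toReal_sum_of_mem_dom (θ := fun i y => θ i (P i y)) hb' hmem,
    toReal_sum_of_mem_dom (θ := fun i y => θ i (P i y)) hb' hy, add_sub_cancel_left, ← hl',
    ← Finset.add_sum_erase _ _ (Finset.mem_univ i), ← Finset.add_sum_erase _ _ (Finset.mem_univ i),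
    e1] at h1
  have h2 : ∑ j ∈ Finset.univ.erase i, (θ j (P j (y + J i (u - P i y)))).toReal =
      ∑ j ∈ Finset.univ.erase i, (θ j (P j y)).toReal :=
    Finset.sum_congr rfl fun j hj => by rw [e2 j (Finset.ne_of_mem_erase hj)]
  rw [h2] at h1
  linarith

/-- Along rays, a separable sum of functions that are linear-quadratic along the components of
the ray is linear-quadratic. -/
theorem exists_ray_sum {P : ∀ i, F →L[ℝ] G i} {θ : ∀ i, G i → EReal} (hb : ∀ i y, θ i y ≠ ⊥)
    {y z : F} {g q s₀ : ι → ℝ} (hs₀ : ∀ i, 0 < s₀ i)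
    (hray : ∀ i, ∀ s : ℝ, 0 ≤ s → s ≤ s₀ i → P i y + s • P i z ∈ dom (θ i) ∧
      (θ i (P i y + s • P i z)).toReal = (θ i (P i y)).toReal + s * g i + s ^ 2 / 2 * q i) :
    ∃ r : ℝ, 0 < r ∧ ∀ s : ℝ, 0 ≤ s → s ≤ r → y + s • z ∈ dom (fun y => ∑ i, θ i (P i y)) ∧
      (∑ i, θ i (P i (y + s • z))).toReal =
        (∑ i, θ i (P i y)).toReal + s * ∑ i, g i + s ^ 2 / 2 * ∑ i, q i := by
  have hb' : ∀ i (y : F), θ i (P i y) ≠ ⊥ := fun i y => hb i _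
  obtain ⟨r, hr, hrs⟩ : ∃ r : ℝ, 0 < r ∧ ∀ i, r ≤ s₀ i := by
    have : ∀ᶠ r in 𝓝[>] (0 : ℝ), ∀ i, r ≤ s₀ i := by
      rw [eventually_all]
      exact fun i => Filter.mem_of_superset (Ioo_mem_nhdsGT (hs₀ i)) fun r hr => hr.2.le
    obtain ⟨r, h1, h2⟩ := (this.and self_mem_nhdsWithin).exists
    exact ⟨r, h2, h1⟩
  refine ⟨r, hr, fun s hs hsr => ?_⟩
  have h1 := fun i => hray i s hs (hsr.trans (hrs i))
  have h0 : ∀ i, P i y ∈ dom (θ i) := fun i => by simpa using (hray i 0 le_rfl (hs₀ i).le).1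
  have e : ∀ i, P i (y + s • z) = P i y + s • P i z := fun i => by rw [map_add, map_smul]
  have hmem : ∀ i, P i (y + s • z) ∈ dom (θ i) := fun i => by rw [e]; exact (h1 i).1
  refine ⟨(mem_dom_sum (θ := fun i y => θ i (P i y)) hb').2 hmem, ?_⟩
  rw [toReal_sum_of_mem_dom (θ := fun i y => θ i (P i y)) hb' hmem,
    toReal_sum_of_mem_dom (θ := fun i y => θ i (P i y)) hb' h0, Finset.mul_sum, Finset.mul_sum,
    ← Finset.sum_add_distrib, ← Finset.sum_add_distrib]
  exact Finset.sum_congr rfl fun i _ => by rw [e, (h1 i).2]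

/-- The metric qualification condition on the domains of the functions `φ i` gives the metric
subregularity qualification condition for the composite representation of their sum. -/
theorem MSQC.sum {X : Type*} [NormedAddCommGroup X]
    {P : ∀ i, F →L[ℝ] G i} {J : ∀ i, G i →L[ℝ] F} (hPJ : ∀ i y, P i (J i y) = y)
    (hPJ' : ∀ i j, i ≠ j → ∀ y, P i (J j y) = 0) {θ : ∀ i, G i → EReal}
    (hb : ∀ i y, θ i y ≠ ⊥) {f : ∀ i, X → G i} {φ : ι → X → EReal} {x : X}
    (hx : ∀ i, x ∈ dom (φ i)) (hm : ∀ i, MSQC (θ i) (f i) x)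
    (hφ : ∀ i, ∀ᶠ y in 𝓝 x, φ i y = θ i (f i y)) {κ : ℝ} (hκ : 0 ≤ κ)
    (hmq : ∀ᶠ y in 𝓝 x, Metric.infDist y (⋂ i, dom (φ i)) ≤
      κ * ∑ i, Metric.infDist y (dom (φ i))) :
    MSQC (fun y => ∑ i, θ i (P i y)) (fun y => ∑ i, J i (f i y)) x := by
  have hb' : ∀ i (y : F), θ i (P i y) ≠ ⊥ := fun i y => hb i _
  have hPf : ∀ z i, P i (∑ j, J j (f j z)) = f i z := fun z i =>
    proj_sum_eq hPJ hPJ' (fun j => f j z) i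
  have hfd : ∀ z, (∑ j, J j (f j z)) ∈ dom (fun y => ∑ i, θ i (P i y)) ↔
      ∀ i, f i z ∈ dom (θ i) := fun z => by
    rw [mem_dom_sum (θ := fun i y => θ i (P i y)) hb']
    exact forall_congr' fun i => by rw [← hPf z i]; rfl
  have hiff : ∀ᶠ z in 𝓝 x, ∀ i, z ∈ {z | f i z ∈ dom (θ i)} ↔ z ∈ dom (φ i) := by
    filter_upwards [eventually_all.2 hφ] with z hz i
    simp only [dom, Set.mem_ofPred_eq, hz i]
  have hx' : ∀ i, x ∈ {z | f i z ∈ dom (θ i)} := fun i => (hiff.self_of_nhds i).2 (hx i)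
  choose K hK hKm using hm
  have h1 := eventually_infDist_eq (S := {z | (∑ j, J j (f j z)) ∈ dom (fun y => ∑ i, θ i (P i y))})
    (S' := ⋂ i, dom (φ i)) ((hfd x).2 hx') (Set.mem_iInter.2 hx) (by
      filter_upwards [hiff] with z hz
      rw [Set.mem_iInter]
      exact (hfd z).trans (forall_congr' hz))
  have h2 := eventually_all.2 fun i => eventually_infDist_eq (hx' i) (hx i)
    (hiff.mono fun z hz => hz i)
  -- The constant chains the condition on the domains, the estimate for each `f i` and the Lipschitz
  -- constants of the projections.
  refine ⟨κ * ∑ i, K i * (‖P i‖ + 1), mul_nonneg hκ (Finset.sum_nonneg fun i _ =>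
    mul_nonneg (hK i) (by positivity)), ?_⟩
  filter_upwards [h1, h2, eventually_all.2 hKm, hmq] with y hy1 hy2 hy3 hy4
  rw [hy1, mul_assoc]
  refine hy4.trans (mul_le_mul_of_nonneg_left ?_ hκ)
  rw [Finset.sum_mul]
  refine Finset.sum_le_sum fun i _ => ?_
  rw [← hy2 i, mul_assoc]
  refine (hy3 i).trans (mul_le_mul_of_nonneg_left ?_ (hK i))
  have := infDist_map_le (P i) (S := dom (fun y => ∑ i, θ i (P i y))) (S' := dom (θ i))
    ⟨_, (hfd x).2 hx'⟩ (fun z hz => (mem_dom_sum (θ := fun i y => θ i (P i y)) hb').1 hz i)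
    (∑ j, J j (f j y))
  rwa [hPf] at this

/-- The sum rule for second subderivatives, for explicit composite representations. -/
theorem exists_sum_secondSubderivative_ge [FiniteDimensional ℝ E] [FiniteDimensional ℝ F]
    [∀ i, FiniteDimensional ℝ (G i)]
    {P : ∀ i, F →L[ℝ] G i} {J : ∀ i, G i →L[ℝ] F} (hPJ : ∀ i y, P i (J i y) = y)
    (hPJ' : ∀ i j, i ≠ j → ∀ y, P i (J j y) = 0) {θ : ∀ i, G i → EReal} {f : ∀ i, E → G i}
    {φ : ι → E → EReal} {x : E}
    (hf : ∀ i, TwiceDifferentiableAt (f i) x) (hp : ∀ i, IsPLQ (θ i))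
    (hx : ∀ i, f i x ∈ dom (θ i)) (hφ : ∀ i, ∀ᶠ y in 𝓝 x, φ i y = θ i (f i y))
    (hc : IsConvexFun fun y : F => ∑ i, θ i (P i y)) (hp' : IsPLQ fun y : F => ∑ i, θ i (P i y))
    (hm : MSQC (fun y => ∑ i, θ i (P i y)) (fun y => ∑ i, J i (f i y)) x)
    {v₀ : E} (hv₀ : v₀ ∈ limitingSubdifferential (fun y => ∑ i, φ i y) x) (w : E) :
    ∃ v : ι → E, (∀ i, v i ∈ limitingSubdifferential (φ i) x) ∧ ∑ i, v i = v₀ ∧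
      secondSubderivative (fun y => ∑ i, φ i y) x v₀ w ≤
        ∑ i, secondSubderivative (φ i) x (v i) w := by
  have hb : ∀ i y, θ i y ≠ ⊥ := fun i => (hp i).ne_bot
  have hPf : ∀ z i, P i (∑ j, J j (f j z)) = f i z := fun z i =>
    proj_sum_eq hPJ hPJ' (fun j => f j z) i
  have hfs := TwiceDifferentiableAt.sum_comp J hf
  have hT : ∀ u, fderiv ℝ (fun y => ∑ i, J i (f i y)) x u =
      ∑ i, J i (fderiv ℝ (f i) x u) := fun u => by
    rw [(hasFDerivAt_sum_comp J fun i => (hf i).1.self_of_nhds).fderiv]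
    simp
  have hB : fderiv ℝ (fderiv ℝ (fun y => ∑ i, J i (f i y))) x w w =
      ∑ i, J i (fderiv ℝ (fderiv ℝ (f i)) x w w) := by
    rw [(hasFDerivAt_fderiv_sum_comp J hf).fderiv]
    simp
  have hxs : (∑ j, J j (f j x)) ∈ dom (fun y => ∑ i, θ i (P i y)) :=
    (mem_dom_sum (θ := fun i y => θ i (P i y)) fun i y => hb i _).2 fun i => by
      change P i (∑ j, J j (f j x)) ∈ dom (θ i)
      rw [hPf]; exact hx i
  have hφs : ∀ᶠ y in 𝓝 x, ∑ i, φ i y = ∑ i, θ i (P i (∑ j, J j (f j y))) := by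
    filter_upwards [eventually_all.2 hφ] with y hy
    exact Finset.sum_congr rfl fun i _ => by rw [hPf, hy i]
  let V : F → ι → E := fun l i => LinearMap.adjoint (fderiv ℝ (f i) x).toLinearMap
    (LinearMap.adjoint (J i).toLinearMap l)
  have hV1 : ∀ l i u, inner ℝ (LinearMap.adjoint (J i).toLinearMap l) u = inner ℝ l (J i u) :=
    fun l i u => LinearMap.adjoint_inner_left _ _ _
  have hV2 : ∀ l i u, inner ℝ (LinearMap.adjoint (J i).toLinearMap l) (fderiv ℝ (f i) x u) =
      inner ℝ (V l i) u := fun l i u => (LinearMap.adjoint_inner_left _ _ _).symm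
  have hsub : ∀ l, IsSubgradient (fun y => ∑ i, θ i (P i y)) (∑ j, J j (f j x)) l →
      ∀ i, IsSubgradient (θ i) (f i x) (LinearMap.adjoint (J i).toLinearMap l) := by
    intro l hl i
    have := hl.of_separable hPJ hPJ' hb (fun i => by rw [hPf]; exact hx i) i (hV1 l i)
    rwa [hPf] at this
  have hVsum : ∀ l, (∀ u, inner ℝ l (fderiv ℝ (fun y => ∑ i, J i (f i y)) x u) = inner ℝ v₀ u) →
      ∑ i, V l i = v₀ := by
    intro l hl
    refine ext_inner_right ℝ fun u => ?_
    rw [← hl u, hT, sum_inner, inner_sum]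
    exact Finset.sum_congr rfl fun i _ => by rw [← hV2, hV1]
  have hVmem : ∀ l, IsSubgradient (fun y => ∑ i, θ i (P i y)) (∑ j, J j (f j x)) l →
      ∀ i, V l i ∈ limitingSubdifferential (φ i) x := fun l hl i =>
    mem_limitingSubdifferential_comp (hf i).1.self_of_nhds (hb i) (hx i) (hφ i) (hV2 l i)
      (hsub l hl i)
  obtain ⟨l, hl1, hl2⟩ := hm.exists_subgradient hfs hc hp' hxs hφs hv₀
  by_cases htop : ∃ i, secondSubderivative (φ i) x (V l i) w = ⊤
  · refine ⟨V l, hVmem l hl2, hVsum l hl1, le_top.trans (ge_of_eq ?_)⟩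
    obtain ⟨i, hi⟩ := htop
    by_contra hne
    have := (sum_lt_top_iff Finset.univ _ fun i _ => secondSubderivative_comp_ne_bot (hf i) (hb i)
      (hx i) (hφ i) (hV2 l i) (hsub l hl2 i) w).1 (lt_top_iff_ne_top.2 hne) i (Finset.mem_univ i)
    exact this.ne hi
  push Not at htop
  -- If `θ i` had every real curvature as a lower estimate, term `i` would be `⊤`. This excludes
  -- both a ray that leaves the domain and a strict gap in slope.
  have hnot : ∀ i, ¬ ∀ M : ℝ, ∀ᶠ p : ℝ × G i in 𝓝[>] (0 : ℝ) ×ˢ 𝓝 (fderiv ℝ (f i) x w),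
      (((θ i (f i x)).toReal + p.1 * inner ℝ (LinearMap.adjoint (J i).toLinearMap l) p.2 +
        p.1 ^ 2 / 2 * M : ℝ) : EReal) ≤ θ i (f i x + p.1 • p.2) := by
    intro i hi
    refine htop i (EReal.eq_top_iff_forall_lt _ |>.2 fun y => ?_)
    refine lt_of_lt_of_le ?_ (le_secondSubderivative_comp (hf i)
      (coe_toReal_of_mem_dom (hb i) (hx i)) (hφ i) (hV2 l i) w
      (y + 1 - inner ℝ (LinearMap.adjoint (J i).toLinearMap l)
        (fderiv ℝ (fderiv ℝ (f i)) x w w)) fun M' _ => hi M')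
    rw [sub_add_cancel]
    exact_mod_cast lt_add_one y
  have hrays : ∀ i, ∃ g q s₀ : ℝ, 0 < s₀ ∧
      (∀ s : ℝ, 0 ≤ s → s ≤ s₀ → f i x + s • fderiv ℝ (f i) x w ∈ dom (θ i) ∧
        (θ i (f i x + s • fderiv ℝ (f i) x w)).toReal =
          (θ i (f i x)).toReal + s * g + s ^ 2 / 2 * q) ∧
      g = inner ℝ (LinearMap.adjoint (J i).toLinearMap l) (fderiv ℝ (f i) x w) ∧
      ∀ l, IsSubgradient (θ i) (f i x) l → ∀ M : ℝ, M < q →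
        ∀ᶠ p : ℝ × G i in 𝓝[>] (0 : ℝ) ×ˢ 𝓝 (fderiv ℝ (f i) x w),
          (((θ i (f i x)).toReal + p.1 * inner ℝ l p.2 + p.1 ^ 2 / 2 * M : ℝ) : EReal) ≤
            θ i (f i x + p.1 • p.2) := by
    intro i
    rcases (hp i).ray (f i x) (fderiv ℝ (f i) x w) with h | ⟨g, q, s₀, hs₀, hray, hM⟩
    · refine absurd (fun M => h.mono fun p hp => ?_) (hnot i)
      rw [eq_top_of_notMem_dom hp]
      exact le_top
    · refine ⟨g, q, s₀, hs₀, hray, le_antisymm ?_ ((hsub l hl2 i).inner_le_of_ray hs₀ hray),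
        fun l hl M hMq => hM l hl M (Or.inr hMq)⟩
      by_contra hlt
      exact hnot i fun M => hM _ (hsub l hl2 i) M (Or.inl (not_le.1 hlt))
  choose g q s₀ hs₀ hray hg hM using hrays
  have hPT : ∀ i, P i (fderiv ℝ (fun y => ∑ i, J i (f i y)) x w) = fderiv ℝ (f i) x w := fun i => by
    rw [hT]
    exact proj_sum_eq hPJ hPJ' (fun j => fderiv ℝ (f j) x w) i
  obtain ⟨r, hr, hrays⟩ := exists_ray_sum (P := P) hb (y := ∑ j, J j (f j x))
    (z := fderiv ℝ (fun y => ∑ i, J i (f i y)) x w) (g := g) (q := q) hs₀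
    (fun i => by rw [hPT, hPf]; exact hray i)
  have hgsum : ∑ i, g i = inner ℝ v₀ w := by
    rw [← hl1 w, hT, inner_sum]
    exact Finset.sum_congr rfl fun i _ => by rw [hg i, hV1]
  rw [hgsum] at hrays
  -- The new multiplier may differ from `l`, but the curvatures `q i` do not depend on it, and the
  -- lower estimates in `hM` hold for every subgradient.
  obtain ⟨l', hl'1, hl'2, hl'3⟩ := hm.exists_subgradient_secondSubderivative_le hfs hc hp' hxs hφs
    (secondSubderivative_comp_ne_bot hfs hp'.ne_bot hxs hφs hl1 hl2 w) hr hrays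
  refine ⟨V l', hVmem l' hl'2, hVsum l' hl'1, hl'3.trans ?_⟩
  rw [hB, inner_sum, ← Finset.sum_add_distrib, coe_sum]
  refine Finset.sum_le_sum fun i _ => ?_
  rw [← hV1]
  exact le_secondSubderivative_comp (hf i) (coe_toReal_of_mem_dom (hb i) (hx i)) (hφ i)
    (hV2 l' i) w (q i) fun M' hM' => hM i _ (hsub l' hl'2 i) M' hM'

end SeparableSum

end VarAnalysis

end

/-! ### The sum rule -/

open VarAnalysis

theorem theorem5p4 {n s : ℕ} (φ : Fin s → EuclideanSpace ℝ (Fin n) → EReal)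
    (hbot : ∀ i x, φ i x ≠ ⊥)
    (x₀ : EuclideanSpace ℝ (Fin n))
    (hφ : ∀ i, VarAnalysis.FullySubamenableAt (φ i) x₀)
    (κ ε : ℝ) (hκ : 0 ≤ κ) (hε : 0 < ε)
    (hmq : ∀ x ∈ Metric.closedBall x₀ ε,
      Metric.infDist x (⋂ i, VarAnalysis.dom (φ i)) ≤
        κ * ∑ i, Metric.infDist x (VarAnalysis.dom (φ i))) :
    VarAnalysis.FullySubamenableAt (fun x => ∑ i, φ i x) x₀ ∧
    (∀ i, ∀ v ∈ VarAnalysis.limitingSubdifferential (φ i) x₀, ∀ w,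
      VarAnalysis.secondSubderivative (φ i) x₀ v w ≠ ⊥) ∧
    ∀ v₀ ∈ VarAnalysis.limitingSubdifferential (fun x => ∑ i, φ i x) x₀, ∀ w,
      IsGreatest
        {r : EReal | ∃ v : Fin s → EuclideanSpace ℝ (Fin n),
          (∀ i, v i ∈ VarAnalysis.limitingSubdifferential (φ i) x₀) ∧ ∑ i, v i = v₀ ∧
          r = ∑ i, VarAnalysis.secondSubderivative (φ i) x₀ (v i) w}
        (VarAnalysis.secondSubderivative (fun x => ∑ i, φ i x) x₀ v₀ w) := by
  choose hx m f θ hf hc hp hm hφθ using hφ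
  have hxθ : ∀ i, f i x₀ ∈ dom (θ i) := fun i => by
    have h := hx i
    rw [dom, Set.mem_ofPred_eq, (hφθ i).self_of_nhds] at h
    exact h
  have hb : ∀ i y, θ i y ≠ ⊥ := fun i => (hp i).ne_bot
  obtain ⟨N, P, J, hPJ, hPJ'⟩ := exists_euclidean_product m
  have hps : IsPLQ fun y => ∑ i, θ i (P i y) :=
    IsPLQ.sum Finset.univ fun i => (hp i).comp_linearMap (P i).toLinearMap
  have hcs : IsConvexFun fun y => ∑ i, θ i (P i y) :=
    (isConvexFun_iff hps.ne_bot).2 (convexOn_sum_toReal (θ := fun i y => θ i (P i y))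
      (fun i y => hb i _)
      fun i => ((isConvexFun_iff (hb i)).1 (hc i)).comp_linearMap (P i).toLinearMap)
  have hms : MSQC (fun y => ∑ i, θ i (P i y)) (fun y => ∑ i, J i (f i y)) x₀ :=
    MSQC.sum hPJ hPJ' hb hx hm hφθ hκ
      (Filter.mem_of_superset (Metric.closedBall_mem_nhds x₀ hε) hmq)
  refine ⟨⟨(mem_dom_sum hbot).2 hx, N, _, _, TwiceDifferentiableAt.sum_comp J hf, hcs, hps,
    hms, ?_⟩,
    ?_, ?_⟩
  · filter_upwards [Filter.eventually_all.2 hφθ] with y hy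
    exact Finset.sum_congr rfl fun i _ => by
      rw [proj_sum_eq hPJ hPJ' (fun j => f j y) i, hy i]
  · intro i v hv w
    obtain ⟨l, hl1, hl2⟩ := (hm i).exists_subgradient (hf i) (hc i) (hp i) (hxθ i) (hφθ i) hv
    exact secondSubderivative_comp_ne_bot (hf i) (hb i) (hxθ i) (hφθ i) hl1 hl2 w
  · intro v₀ hv₀ w
    constructor
    · obtain ⟨v, hv1, hv2, hv3⟩ := exists_sum_secondSubderivative_ge hPJ hPJ' hf hp hxθ hφθ hcs hps
        hms hv₀ w
      refine ⟨v, hv1, hv2, le_antisymm hv3 ?_⟩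
      rw [← hv2]
      exact sum_secondSubderivative_le hbot hx v w
    · rintro _ ⟨v, -, hv2, rfl⟩
      rw [← hv2]
      exact sum_secondSubderivative_le hbot hx v w
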